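/- **Setting.** Let $F_{m,i}:\mathbb R^d\to\mathbb R^d$ ($1\le m\le M$, $1\le i\le n$), $F_m=\frac1n\sum_{i=1}^nF_{m,i}$, and let $g:\mathbb R^d\to\mathbb R\cup\{+\infty\}$ be proper, lower semicontinuous and convex. Let $z^*$ solve the variational inequality $\langle \sum_{m}F_m(z^*),z-z^*\rangle+g(z)-g(z^*)\ge 0$ for all $z\in\mathbb R^d$. Assume, with $\mu,L,\overline L>0$, that for all $m$ and all $u,v$: $\|F_m(u)-F_m(v)\|\le L\|u-v\|$, $\ \frac1n\sum_i\|F_{m,i}(u)-F_{m,i}(v)\|^2\le\overline L^2\|u-v\|^2$ and $\langle F_m(u)-F_m(v),u-v\rangle\ge\mu\|u-v\|^2$. Let $\mathbf W$ be a gossip matrix of a connected undirected graph on the $M$ workers: $\mathbf W$ is symmetric positive semidefinite, $\ker\mathbf W$ consists exactly of the constant vectors, $w_{ij}\ne0$ if and only if $i=j$ or $(i,j)$ is an edge, and $\lambda_{\max}(\mathbf W)=1$. For such matrices put $\chi(\cdot)=\lambda_{\max}/\lambda_{\min}^+$, where $\lambda^+_{\min}$ is the smallest positive eigenvalue, and let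 $\chi=\chi(\mathbf W)$. Let $K=\lfloor\sqrt{\chi}\rfloor$ and $$P(x)=1-\frac{T_K\big(c_2(1-c_3x)\big)}{T_K(c_2)},\qquad c_2=\frac{\chi+1}{\chi-1},\quad c_3=\frac{2}{\lambda_{\max}(\mathbf W)+\lambda^+_{\min}(\mathbf W)},$$ where $T_K$ is the Chebyshev polynomial of degree $K$ ($P(x)=x$ if $\chi=1$), and let $\widehat{\mathbf W}=P(\mathbf W)/\lambda_{\max}(P(\mathbf W))$. Multiplication by $P(\mathbf W)\otimes\mathbf I_d$ is carried out by the recursion $\mathbf v^0=\mathbf v$, $\mathbf v^1=c_2(\mathbf I-c_3\mathbf W)\mathbf v$, $\mathbf v^{k+1}=2c_2(\mathbf I-c_3\mathbf W)\mathbf v^k-\mathbf v^{k-1}$, with output $\mathbf v-\mathbf v^K/T_K(c_2)$. One multiplication by $\mathbf W\otimes \mathbf I_d$ is one communication round. **Algorithm.** For $\mathbf z=(z_1,\dots,z_M)\in(\mathbb R^d)^M$ put $\mathbf F(\mathbf z)=(F_1(z_1),\dots,F_M(z_M))$, $\mathbf g(\mathbf z)=\frac1M\sum_mg(z_m)$,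 and $\mathbf F_j(\mathbf z)=(F_{1,j_1}(z_1),\dots,F_{M,j_M}(z_M))$ for $j\in[n]^M$. Let $1\le b\le n$ be an integer and $0<p\le\frac18$. Start from $\mathbf z^{-1}=\mathbf z^0=\mathbf w^{-1}=\mathbf w^0\in(\operatorname{dom}g)^M$ and $\mathbf y^{-1}=\mathbf y^0$ with $\sum_my^0_m=0$. At iteration $k\ge 0$ draw two batches $S^k$, $S^{k+1/2}$, each of $b$ elements of $[n]^M$; all coordinates of all elements are uniform on $[n]$ and independent of each other and of all earlier draws. Then set $$\begin{aligned} \delta^k&=\tfrac1b\sum_{j\in S^k}\big(\mathbf F_j(\mathbf z^k)-\mathbf F_j(\mathbf w^{k-1})+\alpha[\mathbf F_j(\mathbf z^k)-\mathbf F_j(\mathbf z^{k-1})]\big)+\mathbf F(\mathbf w^{k-1}),\\ \Delta^k&=\delta^k-\big(\mathbf y^k+\alpha(\mathbf y^k-\mathbf y^{k-1})\big),\qquad \mathbf z^{k+1}=\mathrm{prox}_{\eta\mathbf g}\big(\mathbf z^k+\gamma(\mathbf w^k-\mathbf z^k)-\eta\Delta^k\big),\\ \Delta^{k+1/2}&=\tfrac1b\sum_{j\in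 S^{k+1/2}}\big(\mathbf F_j(\mathbf z^{k+1})-\mathbf F_j(\mathbf w^k)\big)+\mathbf F(\mathbf w^k),\\ \mathbf y^{k+1}&=\mathbf y^k-\theta(\widehat{\mathbf W}\otimes\mathbf I_d)\big(\mathbf z^{k+1}-\beta(\Delta^{k+1/2}-\mathbf y^k)\big), \end{aligned}$$ and, independently, $\mathbf w^{k+1}=\mathbf z^k$ with probability $p$ and $\mathbf w^{k+1}=\mathbf w^k$ otherwise. With $\hat\chi=\chi(\widehat{\mathbf W})$ the parameters are $$\gamma=p,\quad \eta=\min\Big\{\tfrac{\sqrt{\gamma b}}{4\overline L},\tfrac1{16L\sqrt{\hat\chi}}\Big\},\quad \beta=\min\Big\{\tfrac{\mu}{4L^2},\tfrac{b\gamma}{4\eta\overline L^2}\Big\},\quad \theta=\min\Big\{\tfrac1{2\beta},\tfrac1{16\eta}\Big\},$$ $$\alpha=\max\Big\{1-\tfrac{\mu\eta}4,\;1-\tfrac{\beta\theta}{\hat\chi},\;1-\tfrac{p\eta\mu}{2\gamma+\eta\mu}\Big\}.$$ **Theorem.** $\widehat{\mathbf W}$ is symmetric positive semidefinite, its kernel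 consists exactly of the constant vectors, $\lambda_{\max}(\widehat{\mathbf W})=1$ and $\chi(\widehat{\mathbf W})\le4$; the recursion above computes the multiplication by $P(\mathbf W)\otimes\mathbf I_d$ in at most $\sqrt\chi$ communication rounds. There is a universal constant $C>0$ such that the following holds in every such setting. Write $\mathbf z^*=(z^*,\dots,z^*)$, let $\mathbf y^*$ be the vector with blocks $F_m(z^*)-\frac1M\sum_lF_l(z^*)$, and for $\varepsilon>0$ put $$\ell_\varepsilon=\log\Big(2+\frac{D}{\varepsilon}\Big),\qquad D=\frac{\|\mathbf z^0-\mathbf z^*\|^2}{p}+\frac{\|\mathbf y^0-\mathbf y^*\|^2}{L^2}.$$ For every $\varepsilon>0$ there is an integer $$0\le N\le C\Big[\frac1p+\frac1{\sqrt{pb}}\frac{\overline L}\mu+\frac L\mu\Big]\ell_\varepsilon$$ such that $\mathbb E\|\mathbf z^k-\mathbf z^*\|^2\le\varepsilon$ for all $k\ge N$. The first $N$ iterations use at most $\sqrt\chi\,N$ communication rounds and, in expectation, at most $n+5(b+pn)N$ local computations (evaluations of operators $F_{m,i}$) per worker, where the full value $\mathbf F(\mathbf w)$ is computed once for each new $\mathbf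 w$ and stored. If $p=b/n$, then the number of communication rounds and the expected number of local computations per worker in these $N$ iterations are at most, respectively, $$C\sqrt\chi\Big[\frac nb+\frac{\sqrt n}b\frac{\overline L}\mu+\frac L\mu\Big]\ell_\varepsilon\qquad\text{and}\qquad C\Big[n+\sqrt n\,\frac{\overline L}\mu+b\,\frac L\mu\Big]\ell_\varepsilon .$$ If moreover $b=\overline L\sqrt n/L$ up to rounding, in the sense that $\overline L\sqrt n/L\le b\le2\overline L\sqrt n/L$, then these numbers are at most $C\sqrt\chi\,\big[\sqrt n\,\frac{L}{\overline L}+\frac L\mu\big]\ell_\varepsilon$ and $C\big[n+\sqrt n\,\frac{\overline L}\mu\big]\ell_\varepsilon$. -/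

import Mathlib

open MeasureTheory ProbabilityTheory
open scoped InnerProductSpace

noncomputable section

namespace DecVI

/-- The space `ℝ^d` of one worker. -/
abbrev Vec (d : ℕ) := EuclideanSpace ℝ (Fin d)

/-- The lifted space `(ℝ^d)^M`, with the Euclidean norm `‖z‖² = ∑ₘ ‖zₘ‖²`. -/
abbrev Stack (M d : ℕ) := PiLp 2 (fun _ : Fin M => Vec d)

/-- The stacked vector with the given blocks. -/
def stack {M d : ℕ} (v : Fin M → Vec d) : Stack M d := WithLp.toLp 2 v

/-- The consensus space: all blocks are equal. -/
def consensus (M d : ℕ) : Submodule ℝ (Stack M d) where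
  carrier := {z | ∀ i j, z i = z j}
  zero_mem' := fun _ _ => rfl
  add_mem' := fun {a b} ha hb i j => by
    simp only [Set.mem_ofPred_eq, PiLp.add_apply] at *
    rw [ha i j, hb i j]
  smul_mem' := fun c {a} ha i j => by
    simp only [Set.mem_ofPred_eq, PiLp.smul_apply] at *
    rw [ha i j]

/-! ### The variational inequality -/

/-- Proper lower semicontinuous convex functions with values in `ℝ ∪ {+∞}`
(convexity is convexity of the epigraph). -/
structure IsProperLscConvex {d : ℕ} (g : Vec d → EReal) : Prop where
  ne_bot : ∀ x, g x ≠ ⊥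
  proper : ∃ x, g x ≠ ⊤
  lsc : LowerSemicontinuous g
  convex : Convex ℝ {q : Vec d × ℝ | g q.1 ≤ (q.2 : EReal)}

/-- The local operator `F_m = (1/n) ∑ᵢ F_{m,i}`. -/
def localOp {M n d : ℕ} (F : Fin M → Fin n → Vec d → Vec d) (m : Fin M) (x : Vec d) : Vec d :=
  (n : ℝ)⁻¹ • ∑ i, F m i x

/-- `zs` solves the variational inequality of the operator `∑ₘ F_m` and of `g`:
`⟨∑ₘ F_m(zs), z - zs⟩ + g(z) - g(zs) ≥ 0` for all `z`. -/
def IsSolution {M n d : ℕ} (F : Fin M → Fin n → Vec d → Vec d) (g : Vec d → EReal)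
    (zs : Vec d) : Prop :=
  g zs ≠ ⊤ ∧ ∀ z, g zs ≤ g z + ((⟪∑ m, localOp F m zs, z - zs⟫_ℝ : ℝ) : EReal)

/-- Each `F_m` is `L`-Lipschitz, and each family `(F_{m,i})ᵢ` is `Lbar`-average Lipschitz. -/
structure IsLip {M n d : ℕ} (F : Fin M → Fin n → Vec d → Vec d) (L Lbar : ℝ) : Prop where
  lip : ∀ m u v, ‖localOp F m u - localOp F m v‖ ≤ L * ‖u - v‖
  avg_lip : ∀ m u v, (n : ℝ)⁻¹ * ∑ i, ‖F m i u - F m i v‖ ^ 2 ≤ Lbar ^ 2 * ‖u - v‖ ^ 2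

/-- Each `F_m` is `μ`-strongly monotone. -/
def IsStronglyMonotone {M n d : ℕ} (F : Fin M → Fin n → Vec d → Vec d) (μ : ℝ) : Prop :=
  ∀ m u v, μ * ‖u - v‖ ^ 2 ≤ ⟪localOp F m u - localOp F m v, u - v⟫_ℝ

/-- The lifted operator `𝐅(z) = (F_1(z_1), …, F_M(z_M))`. -/
def liftOp {M n d : ℕ} (F : Fin M → Fin n → Vec d → Vec d) (z : Stack M d) : Stack M d :=
  stack fun m => localOp F m (z m)

/-- The sampled lifted operator `(F_{1,j_1}(z_1), …, F_{M,j_M}(z_M))`. -/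
def sampleOp {M n d : ℕ} (F : Fin M → Fin n → Vec d → Vec d) (j : Fin M → Fin n)
    (z : Stack M d) : Stack M d :=
  stack fun m => F m (j m) (z m)

/-- The lifted function `𝐠(z) = (1/M) ∑ₘ g(z_m)`. -/
def liftFun {M d : ℕ} (g : Vec d → EReal) (z : Stack M d) : EReal :=
  (((M : ℝ)⁻¹ : ℝ) : EReal) * ∑ m, g (z m)

/-- `prox_{ρ h}(v)`: the minimizer of `ρ h(y) + ‖y - v‖² / 2`. -/
def prox {E : Type*} [NormedAddCommGroup E] (ρ : ℝ) (h : E → EReal) (v : E) : E :=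
  letI : Nonempty E := ⟨v⟩
  Classical.epsilon fun y => ∀ u,
    (ρ : EReal) * h y + ((‖y - v‖ ^ 2 / 2 : ℝ) : EReal) ≤
      (ρ : EReal) * h u + ((‖u - v‖ ^ 2 / 2 : ℝ) : EReal)

/-- The projection of `𝐅(z*)` onto the orthogonal complement of the consensus space:
the limit of the variables `y`. -/
def yStar {M n d : ℕ} (F : Fin M → Fin n → Vec d → Vec d) (zs : Vec d) : Stack M d :=
  stack fun m => localOp F m zs - (M : ℝ)⁻¹ • ∑ l, localOp F l zs

/-! ### Gossip matrices -/

/-- The largest eigenvalue. -/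
def lamMax {M : ℕ} (W : Matrix (Fin M) (Fin M) ℝ) : ℝ := sSup (spectrum ℝ W)

/-- The smallest positive eigenvalue. -/
def lamMinPos {M : ℕ} (W : Matrix (Fin M) (Fin M) ℝ) : ℝ := sInf {t ∈ spectrum ℝ W | 0 < t}

/-- The characteristic number `χ = λ_max / λ_min⁺`. -/
def charNum {M : ℕ} (W : Matrix (Fin M) (Fin M) ℝ) : ℝ := lamMax W / lamMinPos W

/-- Symmetric positive semidefinite matrices whose kernel is the consensus space and
whose largest eigenvalue is `1`. -/
structure IsGossip {M : ℕ} (W : Matrix (Fin M) (Fin M) ℝ) : Prop where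
  posSemidef : W.PosSemidef
  ker_eq : ∀ x : Fin M → ℝ, W.mulVec x = 0 ↔ ∀ i j, x i = x j
  lamMax_eq : lamMax W = 1

/-- Gossip matrices of the graph `G`: the support is exactly the vertices and edges of `G`. -/
structure IsGossipOn {M : ℕ} (G : SimpleGraph (Fin M)) (W : Matrix (Fin M) (Fin M) ℝ) : Prop
    extends IsGossip W where
  support : ∀ i j, W i j ≠ 0 ↔ i = j ∨ G.Adj i j

/-- Multiplication by `A ⊗ I_d`. For the gossip matrix of the network this is one
communication round. -/
def applyMat {M d : ℕ} (A : Matrix (Fin M) (Fin M) ℝ) (z : Stack M d) : Stack M d :=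
  stack fun i => ∑ j, A i j • z j

/-! ### Chebyshev acceleration -/

/-- The constant `c₂ = (χ + 1) / (χ - 1)`. -/
def cTwo {M : ℕ} (W : Matrix (Fin M) (Fin M) ℝ) : ℝ := (charNum W + 1) / (charNum W - 1)

/-- The constant `c₃ = 2 / (λ_max + λ_min⁺)`. -/
def cThree {M : ℕ} (W : Matrix (Fin M) (Fin M) ℝ) : ℝ := 2 / (lamMax W + lamMinPos W)

/-- The number `⌊√χ⌋` of gossip steps in one call of the Chebyshev subroutine. -/
def chebSteps {M : ℕ} (W : Matrix (Fin M) (Fin M) ℝ) : ℕ := ⌊Real.sqrt (charNum W)⌋₊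

/-- The Chebyshev polynomial `P(x) = 1 - T_K(c₂ (1 - c₃ x)) / T_K(c₂)`, `K = ⌊√χ⌋`.
If `χ = 1`, where `c₂` is not defined, `P(x) = x`. -/
def chebPoly {M : ℕ} (W : Matrix (Fin M) (Fin M) ℝ) : Polynomial ℝ :=
  open Classical in
  if charNum W = 1 then Polynomial.X
  else 1 - Polynomial.C ((Polynomial.Chebyshev.T ℝ (chebSteps W)).eval (cTwo W))⁻¹ *
    (Polynomial.Chebyshev.T ℝ (chebSteps W)).comp
      (Polynomial.C (cTwo W) * (1 - Polynomial.C (cThree W) * Polynomial.X))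

/-- The matrix `P(W)`. -/
def chebMat {M : ℕ} (W : Matrix (Fin M) (Fin M) ℝ) : Matrix (Fin M) (Fin M) ℝ :=
  Polynomial.aeval W (chebPoly W)

/-- `P(W)` in the normalization `λ_max = 1` of gossip matrices. -/
def chebGossipMat {M : ℕ} (W : Matrix (Fin M) (Fin M) ℝ) : Matrix (Fin M) (Fin M) ℝ :=
  (lamMax (chebMat W))⁻¹ • chebMat W

/-- State of the Chebyshev subroutine; `rounds` counts the multiplications by `W ⊗ I_d`. -/
structure ChebState (M d : ℕ) where
  /-- the iterate `z^{k-1}` -/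
  prev : Stack M d
  /-- the iterate `z^k` -/
  cur : Stack M d
  /-- the number `a_{k-1}` -/
  aPrev : ℝ
  /-- the number `a_k` -/
  aCur : ℝ
  /-- communication rounds so far -/
  rounds : ℕ

/-- The state for `k = 1`. -/
def chebInit {M d : ℕ} (W : Matrix (Fin M) (Fin M) ℝ) (z : Stack M d) : ChebState M d where
  prev := z
  cur := cTwo W • (z - cThree W • applyMat W z)
  aPrev := 1
  aCur := cTwo W
  rounds := 1

/-- From `k` to `k + 1`. -/
def chebStep {M d : ℕ} (W : Matrix (Fin M) (Fin M) ℝ) (s : ChebState M d) : ChebState M d where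
  prev := s.cur
  cur := (2 * cTwo W) • (s.cur - cThree W • applyMat W s.cur) - s.prev
  aPrev := s.aCur
  aCur := 2 * cTwo W * s.aCur - s.aPrev
  rounds := s.rounds + 1

/-- The Chebyshev gossip subroutine: its output `z^0 - z^K / a_K` and the number of
multiplications by `W ⊗ I_d`. If `χ = 1` it is one multiplication by `W ⊗ I_d`. -/
def chebGossip {M d : ℕ} (W : Matrix (Fin M) (Fin M) ℝ) (z : Stack M d) : Stack M d × ℕ :=
  open Classical in
  if charNum W = 1 then (applyMat W z, 1)
  else
    let s := (chebStep W)^[chebSteps W - 1] (chebInit W z)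
    (z - s.aCur⁻¹ • s.cur, s.rounds)

/-! ### The algorithm -/

/-- Stepsizes `η, θ` and momentums `α, β, γ`. -/
structure Params where
  /-- stepsize of `z` -/
  η : ℝ
  /-- stepsize of `y` -/
  θ : ℝ
  /-- momentum -/
  α : ℝ
  /-- momentum -/
  β : ℝ
  /-- momentum -/
  γ : ℝ

/-- The tuning of the parameters for a gossip matrix with characteristic number `χ`. -/
def tuning (μ L Lbar p : ℝ) (b : ℕ) (χ : ℝ) : Params :=
  let γ := p
  let η := min (Real.sqrt (γ * b) / (4 * Lbar)) (1 / (16 * L * Real.sqrt χ))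
  let β := min (μ / (4 * L ^ 2)) (b * γ / (4 * η * Lbar ^ 2))
  let θ := min (1 / (2 * β)) (1 / (16 * η))
  let α := max (max (1 - μ * η / 4) (1 - β * θ * χ⁻¹)) (1 - p * η * μ / (2 * γ + η * μ))
  { η := η, θ := θ, α := α, β := β, γ := γ }

/-- The random choices of one iteration: the indices `j_{m,l}^k`, the indices
`j_{m,l}^{k+1/2}`, and the coin that decides the update of `w`. -/
abbrev Sample (M n b : ℕ) :=
  (Fin M → Fin b → Fin n) × (Fin M → Fin b → Fin n) × Bool

/-- The probability of a sample: all indices independent and uniform on `n` values, the coin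
independent of them and `true` with probability `p`. -/
def sampleProb {M n b : ℕ} (p : ℝ) (s : Sample M n b) : ℝ :=
  ((n : ℝ)⁻¹) ^ (M * b) * ((n : ℝ)⁻¹) ^ (M * b) * (if s.2.2 = true then p else 1 - p)

/-- The random choices `ξ 0, ξ 1, …` of the iterations are independent with law `sampleProb`. -/
structure IsSampling {M n b : ℕ} {Ω : Type*} [MeasurableSpace Ω] (P : Measure Ω) (p : ℝ)
    (ξ : ℕ → Ω → Sample M n b) : Prop where
  measurable : ∀ k, Measurable (ξ k)
  indep : iIndepFun ξ P
  law : ∀ k s, P (ξ k ⁻¹' {s}) = ENNReal.ofReal (sampleProb p s)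

/-- State of the algorithm before iteration `k`, with two counters. -/
structure State (M d : ℕ) where
  /-- `z^k` -/
  z : Stack M d
  /-- `z^{k-1}` -/
  zPrev : Stack M d
  /-- `w^k` -/
  w : Stack M d
  /-- `w^{k-1}` -/
  wPrev : Stack M d
  /-- `y^k` -/
  y : Stack M d
  /-- `y^{k-1}` -/
  yPrev : Stack M d
  /-- communication rounds (multiplications by `W ⊗ I_d`) so far -/
  rounds : ℕ
  /-- local computations (evaluations of some `F_{m,i}` by worker `m`) so far, per worker;
  the full value `𝐅(w)` is computed once for each value of `w` and stored -/
  calls : ℕ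

/-- Initialization `z^{-1} = z^0 = w^{-1} = w^0`, `y^{-1} = y^0`. The `n` local computations
are those of `𝐅(w^0)`. -/
def initState {M d : ℕ} (n : ℕ) (z0 y0 : Stack M d) : State M d where
  z := z0
  zPrev := z0
  w := z0
  wPrev := z0
  y := y0
  yPrev := y0
  rounds := 0
  calls := n

/-- One iteration of the algorithm with `P(W)`, normalized, as gossip matrix. The batch
`S^k` is used at `z^k, w^{k-1}, z^{k-1}` and `S^{k+1/2}` at `z^{k+1}, w^k`: this takes `5 b`
local computations; when `w` changes, `n` more are needed for the new full value `𝐅(w)`. -/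
def step {M n d b : ℕ} (F : Fin M → Fin n → Vec d → Vec d) (g : Vec d → EReal)
    (W : Matrix (Fin M) (Fin M) ℝ) (c : Params) (s : State M d) (r : Sample M n b) :
    State M d :=
  let δ : Stack M d := (b : ℝ)⁻¹ • (∑ l,
      ((sampleOp F (fun m => r.1 m l) s.z - sampleOp F (fun m => r.1 m l) s.wPrev) +
        c.α • (sampleOp F (fun m => r.1 m l) s.z - sampleOp F (fun m => r.1 m l) s.zPrev))) +
    liftOp F s.wPrev
  let Δ : Stack M d := δ - (s.y + c.α • (s.y - s.yPrev))
  let zNew : Stack M d := prox c.η (liftFun g) (s.z + c.γ • (s.w - s.z) - c.η • Δ)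
  let ΔHalf : Stack M d := (b : ℝ)⁻¹ • (∑ l,
      (sampleOp F (fun m => r.2.1 m l) zNew - sampleOp F (fun m => r.2.1 m l) s.w)) +
    liftOp F s.w
  let q : Stack M d × ℕ := chebGossip W (zNew - c.β • (ΔHalf - s.y))
  { z := zNew
    zPrev := s.z
    w := if r.2.2 = true then s.z else s.w
    wPrev := s.w
    y := s.y - c.θ • (lamMax (chebMat W))⁻¹ • q.1
    yPrev := s.y
    rounds := s.rounds + q.2
    calls := s.calls + 5 * b + if r.2.2 = true then n else 0 }

/-- The state after `k` iterations, given the random choices. -/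
def run {M n d b : ℕ} (F : Fin M → Fin n → Vec d → Vec d) (g : Vec d → EReal)
    (W : Matrix (Fin M) (Fin M) ℝ) (c : Params) (z0 y0 : Stack M d) (r : ℕ → Sample M n b) :
    ℕ → State M d
  | 0 => initState n z0 y0
  | k + 1 => step F g W c (run F g W c z0 y0 r k) (r k)

/-- The iteration complexity `1/p + (1/√(pb)) Lbar/μ + L/μ`, without the logarithm. -/
def rate (μ L Lbar p : ℝ) (b : ℕ) : ℝ :=
  1 / p + 1 / Real.sqrt (p * b) * (Lbar / μ) + L / μ

/-- The logarithm `log (2 + D/ε)`, where `D = ‖z⁰ - z*‖²/p + ‖y⁰ - y*‖²/L²` is the initial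
error. -/
def logTerm {M n d : ℕ} (F : Fin M → Fin n → Vec d → Vec d) (L p : ℝ) (z0 y0 : Stack M d)
    (zs : Vec d) (ε : ℝ) : ℝ :=
  Real.log (2 + (‖z0 - stack (fun _ => zs)‖ ^ 2 / p + ‖y0 - yStar F zs‖ ^ 2 / L ^ 2) / ε)

end DecVI

end

/-! The convergence proof is a one-step contraction of a Lyapunov function. With `D` the
pseudo-inverse of the accelerated gossip matrix, `lyapunov` adds the squared distances of `z` and
`w` to the solution, the dual error `⟪y - ys, D (y - ys)⟫` weighted by `η/θ`, the squares of the
last increments, and two cross terms `⟪F(z) - F(z⁻), z - zs⟫` and `⟪y - y⁻, z - zs⟫`, which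
telescope because the method extrapolates both `F` and `y` by the factor `α`.

The prox inequality at the solution (`primal_step`) produces the coupling `2η⟪yp - ys, zp - zs⟫`.
The dual update, measured in the metric `D`, produces it with the opposite sign (`dual_step`), since
`D` undoes the gossip matrix on the complement of consensus. The `β`-correction in the dual update
adds `-θβ‖y - ys‖²`, which contracts `y` because `D ≤ χ`; strong monotonicity contracts `z` and,
through the coin, `w`. The Lipschitz errors and the batch noise are paid for by the increments.

`Admissible.lyapunov_step` is this estimate for each outcome, with three remainders left over, one
per source of randomness. Averaging the coin, then the second batch, then the first makes each
nonpositive, because batch errors are centered and their variance is bounded by average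
Lipschitzness (`sampleMean_potential_le`). As iterations are independent, the expected potential
decays like `α ^ k`.

Chebyshev acceleration makes the characteristic number at most 4, because `T_K(c₂) ≥ 5/3` already
for `K = ⌊√χ⌋` (`IsGossip.isGossip_chebGossipMat`). The dual gap `βθ/χ` is then no worse than the
others, and `1 - α ≥ 1/(128 · rate)` (`one_le_rate_mul_one_sub_α`). Hence `⌈logTerm/(1 - α)⌉`
iterations suffice; the cost bounds follow by counting rounds and calls per iteration. -/

namespace DecVI

/-! ### Multiplication by `A ⊗ I_d` -/

section ApplyMat

variable {M d : ℕ}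

theorem applyMat_apply (A : Matrix (Fin M) (Fin M) ℝ) (z : Stack M d) (i : Fin M) :
    applyMat A z i = ∑ j, A i j • z j := rfl

theorem applyMat_mul (A B : Matrix (Fin M) (Fin M) ℝ) (z : Stack M d) :
    applyMat (A * B) z = applyMat A (applyMat B z) := by
  ext i c
  simp only [applyMat_apply, Matrix.mul_apply, Finset.sum_smul, Finset.smul_sum, smul_smul]
  rw [Finset.sum_comm]

theorem applyMat_one (z : Stack M d) : applyMat 1 z = z := by
  ext i c
  simp [applyMat_apply, Matrix.one_apply, ite_smul]

theorem applyMat_sub_left (A B : Matrix (Fin M) (Fin M) ℝ) (z : Stack M d) :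
    applyMat (A - B) z = applyMat A z - applyMat B z := by
  ext i c
  simp [applyMat_apply, sub_smul, Finset.sum_sub_distrib]

theorem applyMat_smul_left (r : ℝ) (A : Matrix (Fin M) (Fin M) ℝ) (z : Stack M d) :
    applyMat (r • A) z = r • applyMat A z := by
  ext i c
  simp [applyMat_apply, Finset.smul_sum, smul_smul, mul_assoc]

theorem applyMat_sub (A : Matrix (Fin M) (Fin M) ℝ) (u v : Stack M d) :
    applyMat A (u - v) = applyMat A u - applyMat A v := by
  ext i c
  simp [applyMat_apply, smul_sub, Finset.sum_sub_distrib]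

theorem applyMat_add (A : Matrix (Fin M) (Fin M) ℝ) (u v : Stack M d) :
    applyMat A (u + v) = applyMat A u + applyMat A v := by
  ext i c
  simp [applyMat_apply, smul_add, Finset.sum_add_distrib]

theorem applyMat_smul (A : Matrix (Fin M) (Fin M) ℝ) (r : ℝ) (u : Stack M d) :
    applyMat A (r • u) = r • applyMat A u := by
  ext i c
  simp only [applyMat_apply, PiLp.smul_apply, Finset.smul_sum, smul_smul, mul_comm]

theorem inner_applyMat_right (A : Matrix (Fin M) (Fin M) ℝ) (u v : Stack M d) :
    ⟪u, applyMat A v⟫_ℝ = ⟪applyMat A.transpose u, v⟫_ℝ := by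
  simp only [PiLp.inner_apply (𝕜 := ℝ) (f := fun _ : Fin M => Vec d), applyMat_apply, inner_sum,
    sum_inner, real_inner_smul_right, real_inner_smul_left, Matrix.transpose_apply]
  rw [Finset.sum_comm]

theorem applyMat_eq_zero_iff (A : Matrix (Fin M) (Fin M) ℝ) (z : Stack M d) :
    applyMat A z = 0 ↔ ∀ c, A.mulVec (fun i => z i c) = 0 := by
  constructor
  · intro h c
    ext i
    have := congrArg (fun x : Stack M d => x i c) h
    simpa [applyMat_apply, Matrix.mulVec, dotProduct] using this
  · intro h
    ext i c
    have := congrFun (h c) i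
    simpa [applyMat_apply, Matrix.mulVec, dotProduct] using this

end ApplyMat

/-! ### Spectra of gossip matrices -/

section Spectrum

variable {M : ℕ} {W : Matrix (Fin M) (Fin M) ℝ}

theorem bddAbove_spectrum (W : Matrix (Fin M) (Fin M) ℝ) : BddAbove (spectrum ℝ W) :=
  W.finite_spectrum.bddAbove

theorem IsGossip.isSelfAdjoint (hW : IsGossip W) : IsSelfAdjoint W := hW.posSemidef.isHermitian

theorem IsGossip.le_one (hW : IsGossip W) {t : ℝ} (ht : t ∈ spectrum ℝ W) : t ≤ 1 := by
  rw [← hW.lamMax_eq]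
  exact le_csSup (bddAbove_spectrum W) ht

theorem IsGossip.nonneg (hW : IsGossip W) {t : ℝ} (ht : t ∈ spectrum ℝ W) : 0 ≤ t :=
  (Matrix.posSemidef_iff_isHermitian_and_spectrum_nonneg.1 hW.posSemidef).2 ht

theorem IsGossip.one_mem (hW : IsGossip W) : (1 : ℝ) ∈ spectrum ℝ W := by
  have hne : (spectrum ℝ W).Nonempty := by
    by_contra h
    have h1 := hW.lamMax_eq
    -- The supremum of the empty set of reals is `0`, so the normalization `λ_max = 1` excludes an
    -- empty spectrum.
    rw [lamMax, Set.not_nonempty_iff_eq_empty.1 h, Real.sSup_empty] at h1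
    exact zero_ne_one h1
  have := hne.csSup_mem W.finite_spectrum
  rwa [show sSup (spectrum ℝ W) = 1 from hW.lamMax_eq] at this

theorem IsGossip.lamMinPos_mem (hW : IsGossip W) :
    lamMinPos W ∈ {t ∈ spectrum ℝ W | 0 < t} :=
  Set.Nonempty.csInf_mem ⟨1, hW.one_mem, one_pos⟩ (W.finite_spectrum.subset fun _ h => h.1)

theorem IsGossip.lamMinPos_pos (hW : IsGossip W) : 0 < lamMinPos W := hW.lamMinPos_mem.2

theorem lamMinPos_le {t : ℝ} (ht : t ∈ spectrum ℝ W) (h0 : 0 < t) :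
    lamMinPos W ≤ t :=
  csInf_le ⟨0, fun _ h => h.2.le⟩ ⟨ht, h0⟩

theorem IsGossip.charNum_eq (hW : IsGossip W) : charNum W = (lamMinPos W)⁻¹ := by
  rw [charNum, hW.lamMax_eq, one_div]

theorem IsGossip.one_le_charNum (hW : IsGossip W) : 1 ≤ charNum W := by
  rw [hW.charNum_eq]
  exact (one_le_inv₀ hW.lamMinPos_pos).2 (lamMinPos_le hW.one_mem one_pos)

theorem IsGossip.inv_charNum_le (hW : IsGossip W) {t : ℝ} (ht : t ∈ spectrum ℝ W) (h0 : 0 < t) :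
    (charNum W)⁻¹ ≤ t := by
  rw [hW.charNum_eq, inv_inv]
  exact lamMinPos_le ht h0

/-- Finiteness of the spectrum admits every real function to the functional calculus, including
`t⁻¹` and `t / q(t)`, which may be discontinuous at the eigenvalue `0`. -/
theorem continuousOn_spectrum (W : Matrix (Fin M) (Fin M) ℝ) (f : ℝ → ℝ) :
    ContinuousOn f (spectrum ℝ W) :=
  W.finite_spectrum.continuousOn f

theorem cfc_mul_cfc (f g : ℝ → ℝ) :
    cfc (fun t => f t * g t) W = cfc f W * cfc g W :=
  cfc_mul f g W (continuousOn_spectrum W f) (continuousOn_spectrum W g)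

theorem spectrum_aeval (hW : IsSelfAdjoint W) (q : Polynomial ℝ) :
    spectrum ℝ (Polynomial.aeval W q) = (fun t => q.eval t) '' spectrum ℝ W := by
  rw [← cfc_polynomial q W hW]
  exact cfc_map_spectrum _ W hW (continuousOn_spectrum W _)

/-- A polynomial that vanishes at `0` and is positive on the rest of the spectrum turns a gossip
matrix into a gossip matrix, up to normalization. -/
theorem IsGossip.isGossip_aeval (hW : IsGossip W) {q : Polynomial ℝ} (hq0 : q.eval 0 = 0)
    {lo hi : ℝ} (hlo : 0 < lo)
    (hq : ∀ t ∈ spectrum ℝ W, 0 < t → lo ≤ q.eval t ∧ q.eval t ≤ hi) :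
    IsGossip ((lamMax (Polynomial.aeval W q))⁻¹ • Polynomial.aeval W q) ∧
      charNum ((lamMax (Polynomial.aeval W q))⁻¹ • Polynomial.aeval W q) ≤ hi / lo := by
  set m := lamMax (Polynomial.aeval W q) with hm
  have hspec := spectrum_aeval hW.isSelfAdjoint q
  have hmem1 : q.eval 1 ∈ spectrum ℝ (Polynomial.aeval W q) := by
    rw [hspec]; exact ⟨1, hW.one_mem, rfl⟩
  have hmmem : m ∈ spectrum ℝ (Polynomial.aeval W q) :=
    Set.Nonempty.csSup_mem ⟨_, hmem1⟩ (Matrix.finite_spectrum _)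
  have hmlo : lo ≤ m :=
    (hq 1 hW.one_mem one_pos).1.trans (le_csSup (bddAbove_spectrum _) hmem1)
  have hm0 : 0 < m := hlo.trans_le hmlo
  have hcase : ∀ t ∈ spectrum ℝ W, t = 0 ∨ lo ≤ q.eval t ∧ q.eval t ≤ hi := fun t ht =>
    (hW.nonneg ht).eq_or_lt.imp Eq.symm (hq t ht)
  have hmhi : m ≤ hi := by
    rw [hspec] at hmmem
    obtain ⟨t, ht, htm⟩ := hmmem
    rcases hcase t ht with rfl | h
    · simp only [hq0] at htm; exact absurd htm hm0.ne
    · rw [← htm]; exact h.2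
  have hB : m⁻¹ • Polynomial.aeval W q = Polynomial.aeval W (Polynomial.C m⁻¹ * q) := by
    simp [Algebra.smul_def]
  have hspecB : spectrum ℝ (m⁻¹ • Polynomial.aeval W q) =
      (fun t => m⁻¹ * q.eval t) '' spectrum ℝ W := by
    rw [hB, spectrum_aeval hW.isSelfAdjoint]; simp
  have hle : ∀ s ∈ spectrum ℝ (m⁻¹ • Polynomial.aeval W q), s ≤ 1 := by
    rw [hspecB]
    rintro _ ⟨t, ht, rfl⟩
    have : q.eval t ≤ m := le_csSup (bddAbove_spectrum _) (by rw [hspec]; exact ⟨t, ht, rfl⟩)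
    calc m⁻¹ * q.eval t ≤ m⁻¹ * m := by gcongr
      _ = 1 := inv_mul_cancel₀ hm0.ne'
  have h1 : (1 : ℝ) ∈ spectrum ℝ (m⁻¹ • Polynomial.aeval W q) := by
    rw [hspecB]
    rw [hspec] at hmmem
    obtain ⟨t, ht, htm⟩ := hmmem
    exact ⟨t, ht, by simp only [show q.eval t = m from htm, inv_mul_cancel₀ hm0.ne']⟩
  have hmax : lamMax (m⁻¹ • Polynomial.aeval W q) = 1 :=
    le_antisymm (csSup_le ⟨1, h1⟩ hle) (le_csSup (bddAbove_spectrum _) h1)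
  have hsa : (m⁻¹ • Polynomial.aeval W q).IsHermitian := by
    rw [hB, ← cfc_polynomial _ W hW.isSelfAdjoint]
    exact cfc_predicate _ W
  have hpsd : (m⁻¹ • Polynomial.aeval W q).PosSemidef := by
    refine Matrix.posSemidef_iff_isHermitian_and_spectrum_nonneg.2 ⟨hsa, ?_⟩
    rw [hspecB]
    rintro _ ⟨t, ht, rfl⟩
    rcases hcase t ht with rfl | h
    · simp [hq0]
    · exact mul_nonneg (inv_nonneg.2 hm0.le) (hlo.le.trans h.1)
  have hker : ∀ x : Fin M → ℝ,
      (m⁻¹ • Polynomial.aeval W q).mulVec x = 0 ↔ ∀ i j, x i = x j := by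
    intro x
    rw [← hW.ker_eq, Matrix.smul_mulVec, smul_eq_zero_iff_right (inv_ne_zero hm0.ne')]
    constructor
    · intro h
      -- `W` is a multiple of `q(W)`, so the kernel does not grow. At `t = 0` the convention `0 / 0
      -- = 0` gives the right value; elsewhere on the spectrum `q ≥ lo > 0`.
      have key : W = cfc (fun t => t / q.eval t) W * Polynomial.aeval W q := by
        conv_lhs => rw [← cfc_id' ℝ W hW.isSelfAdjoint]
        rw [← cfc_polynomial q W hW.isSelfAdjoint, ← cfc_mul_cfc]
        refine cfc_congr fun t ht => ?_
        rcases hcase t ht with rfl | h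
        · simp
        · have : q.eval t ≠ 0 := (hlo.trans_le h.1).ne'
          field_simp
      rw [key, ← Matrix.mulVec_mulVec, h, Matrix.mulVec_zero]
    · intro h
      obtain ⟨r, hr⟩ := Polynomial.X_dvd_iff.2 (Polynomial.coeff_zero_eq_eval_zero q ▸ hq0)
      rw [hr, mul_comm, map_mul, Polynomial.aeval_X, ← Matrix.mulVec_mulVec, h,
        Matrix.mulVec_zero]
  have hgossip : IsGossip (m⁻¹ • Polynomial.aeval W q) := ⟨hpsd, hker, hmax⟩
  refine ⟨hgossip, ?_⟩
  have hmin := hgossip.lamMinPos_mem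
  rw [hgossip.charNum_eq]
  have : lo / hi ≤ lamMinPos (m⁻¹ • Polynomial.aeval W q) := by
    obtain ⟨hs, hpos⟩ := hmin
    generalize lamMinPos (m⁻¹ • Polynomial.aeval W q) = l at hs hpos
    rw [hspecB] at hs
    obtain ⟨t, ht, rfl⟩ := hs
    rcases hcase t ht with rfl | h
    · simp [hq0] at hpos
    · rw [div_eq_inv_mul]
      exact mul_le_mul ((inv_le_inv₀ (hm0.trans_le hmhi) hm0).2 hmhi) h.1 hlo.le
        (inv_nonneg.2 hm0.le)
  calc (lamMinPos (m⁻¹ • Polynomial.aeval W q))⁻¹ ≤ (lo / hi)⁻¹ :=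
        inv_anti₀ (div_pos hlo (hm0.trans_le hmhi)) this
    _ = hi / lo := inv_div _ _

end Spectrum

/-! ### Chebyshev acceleration -/

section Chebyshev

variable {M : ℕ} {W : Matrix (Fin M) (Fin M) ℝ}

/-- `T_k(cosh x) = cosh(kx)` at `x = log r`. -/
theorem eval_T_add_inv (k : ℕ) {r : ℝ} (hr : 0 < r) :
    (Polynomial.Chebyshev.T ℝ k).eval ((r + r⁻¹) / 2) = (r ^ k + (r ^ k)⁻¹) / 2 := by
  have := Polynomial.Chebyshev.T_real_cosh (Real.log r) k
  rw [Real.cosh_log hr, Int.cast_natCast, ← Real.log_pow, Real.cosh_log (pow_pos hr k)] at this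
  exact this

/-- The base is `1 + 2/(s - 1) ≥ 1 + 2/⌊s⌋`, because `s - 1 < ⌊s⌋`; Bernoulli's inequality then
gives `1 + ⌊s⌋ · 2/⌊s⌋ = 3`. -/
theorem three_le_pow_floor {s : ℝ} (hs : 1 < s) : 3 ≤ ((s + 1) / (s - 1)) ^ ⌊s⌋₊ := by
  have hK : 1 ≤ ⌊s⌋₊ := Nat.le_floor (by simpa using hs.le)
  have hK0 : (0 : ℝ) < ⌊s⌋₊ := by exact_mod_cast hK
  have hlt := Nat.lt_floor_add_one s
  have h1 : 1 + 2 / (⌊s⌋₊ : ℝ) ≤ (s + 1) / (s - 1) := by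
    have : (s + 1) / (s - 1) = 1 + 2 / (s - 1) := by
      have : s - 1 ≠ 0 := by linarith
      field_simp; ring
    rw [this]
    have : 2 / (⌊s⌋₊ : ℝ) ≤ 2 / (s - 1) :=
      div_le_div_of_nonneg_left (by norm_num) (by linarith) (by linarith)
    linarith
  calc (3 : ℝ) = 1 + ⌊s⌋₊ * (2 / (⌊s⌋₊ : ℝ)) := by field_simp; norm_num
    _ ≤ (1 + 2 / (⌊s⌋₊ : ℝ)) ^ ⌊s⌋₊ :=
      one_add_mul_le_pow (by have : 0 < 2 / (⌊s⌋₊ : ℝ) := by positivity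
                             linarith) _
    _ ≤ _ := pow_le_pow_left₀ (by positivity) h1 _

/-- With `s = √χ` and `r = (s + 1)/(s - 1)`, the argument is `(r + r⁻¹)/2`, so the value is `(y +
y⁻¹)/2` with `y = r ^ ⌊s⌋ ≥ 3`. The bound is the value at `y = 3`. -/
theorem five_thirds_le_eval_T {χ : ℝ} (hχ : 1 < χ) :
    5 / 3 ≤ (Polynomial.Chebyshev.T ℝ (⌊Real.sqrt χ⌋₊ : ℕ)).eval ((χ + 1) / (χ - 1)) := by
  have hs : 1 < Real.sqrt χ := by
    rw [← Real.sqrt_one]; exact Real.sqrt_lt_sqrt zero_le_one hχ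
  set s := Real.sqrt χ
  have hsq : χ = s ^ 2 := (Real.sq_sqrt (by linarith)).symm
  have h0 : 0 < (s + 1) / (s - 1) := div_pos (by linarith) (by linarith)
  have hc : (χ + 1) / (χ - 1) = ((s + 1) / (s - 1) + ((s + 1) / (s - 1))⁻¹) / 2 := by
    have h1 : s - 1 ≠ 0 := by linarith
    have h2 : s + 1 ≠ 0 := by linarith
    have h3 : s ^ 2 - 1 ≠ 0 := by
      have : s ^ 2 - 1 = (s - 1) * (s + 1) := by ring
      rw [this]; exact mul_ne_zero h1 h2
    rw [hsq]
    field_simp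
    ring
  rw [hc, eval_T_add_inv _ h0]
  have h3 := three_le_pow_floor hs
  set y := ((s + 1) / (s - 1)) ^ ⌊s⌋₊
  have hy : 0 < y := by linarith
  have : 0 ≤ (y - 3) * (y - 1 / 3) / y := by
    apply div_nonneg (mul_nonneg _ _) hy.le <;> linarith
  have h4 : (y - 3) * (y - 1 / 3) / y = y + y⁻¹ - 10 / 3 := by field_simp; ring
  linarith

/-- The map `t ↦ c₂(1 - c₃ t)` carries `[1/χ, 1]` into `[-1, 1]`, where `|T_K| ≤ 1`. With `τ =
T_K(c₂) ≥ 5/3`, the positive spectrum is therefore sent into `[1 - τ⁻¹, 1 + τ⁻¹]`, whose endpoint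
ratio is at most `(8/5)/(2/5) = 4`. If `χ = 1`, the only positive eigenvalue is `1` and `P = X` does
nothing. -/
theorem IsGossip.isGossip_chebGossipMat (hW : IsGossip W) :
    IsGossip (chebGossipMat W) ∧ charNum (chebGossipMat W) ≤ 4 := by
  rcases hW.one_le_charNum.eq_or_lt with h1 | h1
  · have h2 := hW.isGossip_aeval (q := chebPoly W) (lo := 1) (hi := 1)
      (by rw [chebPoly, if_pos h1.symm]; simp) one_pos (by
        intro t ht h0
        have h3 := hW.inv_charNum_le ht h0
        have h4 := hW.le_one ht
        rw [← h1, inv_one] at h3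
        rw [chebPoly, if_pos h1.symm]
        simp [h3, h4])
    exact ⟨h2.1, h2.2.trans (by norm_num)⟩
  · set χ := charNum W with hχ
    set τ := (Polynomial.Chebyshev.T ℝ (chebSteps W)).eval (cTwo W) with hτ
    have hτ5 : 5 / 3 ≤ τ := five_thirds_le_eval_T h1
    have hτ0 : 0 < τ := by linarith
    have heval : ∀ t, (chebPoly W).eval t =
        1 - τ⁻¹ * (Polynomial.Chebyshev.T ℝ (chebSteps W)).eval
          (cTwo W * (1 - cThree W * t)) := by
      intro t
      rw [chebPoly, if_neg h1.ne']
      simp [← hτ, Polynomial.eval_comp]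
    have h2 := hW.isGossip_aeval (q := chebPoly W) (lo := 1 - τ⁻¹) (hi := 1 + τ⁻¹)
      (by rw [heval]; simp [← hτ, hτ0.ne'])
      (by have : τ⁻¹ ≤ (5 / 3)⁻¹ := inv_anti₀ (by norm_num) hτ5
          norm_num at this ⊢; linarith) (by
        intro t ht h0
        rw [heval]
        have h3 : χ⁻¹ ≤ t := hW.inv_charNum_le ht h0
        have h4 := hW.le_one ht
        have hle : |cTwo W * (1 - cThree W * t)| ≤ 1 := by
          have hmin : lamMinPos W = χ⁻¹ := by rw [hχ, hW.charNum_eq, inv_inv]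
          have h5 : 1 ≤ χ * t := by
            calc (1 : ℝ) = χ * χ⁻¹ := (mul_inv_cancel₀ (by linarith)).symm
              _ ≤ χ * t := by gcongr
          have h6 : χ * t ≤ χ := by nlinarith
          have : cTwo W * (1 - cThree W * t) = (χ + 1 - 2 * (χ * t)) / (χ - 1) := by
            rw [cTwo, cThree, hW.lamMax_eq, hmin, ← hχ]
            have : χ - 1 ≠ 0 := by linarith
            have : χ + 1 ≠ 0 := by linarith
            have : χ ≠ 0 := by linarith
            field_simp
          rw [this, abs_le]
          constructor
          · rw [le_div_iff₀ (by linarith)]; linarith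
          · rw [div_le_iff₀ (by linarith)]; linarith
        have h7 := Polynomial.Chebyshev.abs_eval_T_real_le_one (chebSteps W) hle
        rw [abs_le] at h7
        have h8 := inv_pos.2 hτ0
        constructor <;> nlinarith)
    refine ⟨h2.1, h2.2.trans ?_⟩
    have h3 : τ⁻¹ ≤ (5 / 3)⁻¹ := inv_anti₀ (by norm_num) hτ5
    norm_num at h3
    rw [div_le_iff₀ (by linarith)]
    linarith

theorem applyMat_chebMat_aux {d : ℕ} (W : Matrix (Fin M) (Fin M) ℝ) (z : Stack M d)
    (p : Polynomial ℝ) :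
    applyMat (Polynomial.aeval W (p.comp
        (Polynomial.C (cTwo W) * (1 - Polynomial.C (cThree W) * Polynomial.X)) *
        (Polynomial.C (cTwo W) * (1 - Polynomial.C (cThree W) * Polynomial.X)))) z =
      cTwo W • (applyMat (Polynomial.aeval W (p.comp
        (Polynomial.C (cTwo W) * (1 - Polynomial.C (cThree W) * Polynomial.X)))) z -
        cThree W • applyMat W (applyMat (Polynomial.aeval W (p.comp
        (Polynomial.C (cTwo W) * (1 - Polynomial.C (cThree W) * Polynomial.X)))) z)) := by
  rw [mul_comm, map_mul, applyMat_mul]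
  have : Polynomial.aeval W
      (Polynomial.C (cTwo W) * (1 - Polynomial.C (cThree W) * Polynomial.X)) =
      cTwo W • ((1 : Matrix (Fin M) (Fin M) ℝ) - cThree W • W) := by
    simp [Algebra.smul_def]
  rw [this, applyMat_smul_left, applyMat_sub_left, applyMat_one, applyMat_smul_left]

/-- The Chebyshev recursion computes the Chebyshev polynomials of `c₂ (I - c₃ W)`. -/
theorem iterate_chebStep {d : ℕ} (W : Matrix (Fin M) (Fin M) ℝ) (z : Stack M d) (k : ℕ) :
    (chebStep W)^[k] (chebInit W z) =
      { prev := applyMat (Polynomial.aeval W ((Polynomial.Chebyshev.T ℝ k).comp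
          (Polynomial.C (cTwo W) * (1 - Polynomial.C (cThree W) * Polynomial.X)))) z
        cur := applyMat (Polynomial.aeval W ((Polynomial.Chebyshev.T ℝ (k + 1)).comp
          (Polynomial.C (cTwo W) * (1 - Polynomial.C (cThree W) * Polynomial.X)))) z
        aPrev := (Polynomial.Chebyshev.T ℝ k).eval (cTwo W)
        aCur := (Polynomial.Chebyshev.T ℝ (k + 1)).eval (cTwo W)
        rounds := k + 1 } := by
  induction k with
  | zero =>
    have h := applyMat_chebMat_aux W z 1
    simp only [Polynomial.one_comp, one_mul, map_one, applyMat_one] at h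
    simp only [chebInit, Function.iterate_zero, id, Nat.cast_zero, zero_add,
      Polynomial.Chebyshev.T_zero, Polynomial.Chebyshev.T_one, Polynomial.X_comp,
      Polynomial.one_comp, map_one, applyMat_one, h, Polynomial.eval_one, Polynomial.eval_X]
  | succ k ih =>
    rw [Function.iterate_succ_apply', ih]
    have hT : Polynomial.Chebyshev.T ℝ ((k : ℤ) + 1 + 1) =
        (2 : ℝ) • (Polynomial.Chebyshev.T ℝ (k + 1) * Polynomial.X) -
          Polynomial.Chebyshev.T ℝ k := by
      rw [add_assoc, one_add_one_eq_two, Polynomial.Chebyshev.T_add_two, Polynomial.smul_eq_C_mul]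
      simp only [map_ofNat]
      ring
    simp only [chebStep, Nat.cast_add, Nat.cast_one, ChebState.mk.injEq, true_and, and_true]
    refine ⟨?_, ?_⟩
    · rw [hT, Polynomial.sub_comp, Polynomial.smul_comp, Polynomial.mul_comp,
        Polynomial.X_comp, map_sub, map_smul, applyMat_sub_left, applyMat_smul_left,
        applyMat_chebMat_aux, smul_smul]
    · rw [hT]
      simp
      ring

theorem IsGossip.chebGossip_spec {d : ℕ} (hW : IsGossip W) (v : Stack M d) :
    (chebGossip W v).1 = applyMat (chebMat W) v ∧
      ((chebGossip W v).2 : ℝ) ≤ Real.sqrt (charNum W) := by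
  have h1 := hW.one_le_charNum
  have hs : 1 ≤ Real.sqrt (charNum W) := by
    rw [← Real.sqrt_one]; exact Real.sqrt_le_sqrt h1
  by_cases h : charNum W = 1
  · rw [chebGossip, if_pos h, chebMat, chebPoly, if_pos h]
    simpa using hs
  · have hK : 1 ≤ chebSteps W := Nat.le_floor (by simpa using hs)
    -- `chebInit` is already at degree 1 and has spent one round, so degree `K` needs `K - 1`
    -- further steps; `K ≥ 1` makes the natural subtraction harmless.
    obtain ⟨k, hk⟩ : ∃ k, chebSteps W = k + 1 := ⟨chebSteps W - 1, by omega⟩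
    rw [chebGossip, if_neg h, chebMat, chebPoly, if_neg h]
    simp only [iterate_chebStep, hk, Nat.add_sub_cancel]
    refine ⟨?_, ?_⟩
    · rw [map_sub, map_one, applyMat_sub_left, applyMat_one,
        ← Polynomial.smul_eq_C_mul (Polynomial.eval _ _)⁻¹, map_smul, applyMat_smul_left]
      push_cast
      rfl
    · rw [← hk]
      exact Nat.floor_le (by positivity)

end Chebyshev

/-! ### The metric of the dual variables -/

section DualMetric

variable {M d : ℕ} {B : Matrix (Fin M) (Fin M) ℝ}

theorem transpose_cfc (f : ℝ → ℝ) : (cfc f B).transpose = cfc f B := by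
  have h : IsSelfAdjoint (cfc f B) := cfc_predicate f B
  rw [IsSelfAdjoint, Matrix.star_eq_conjTranspose, Matrix.conjTranspose_eq_transpose_of_trivial]
    at h
  exact h

/-- `f(B)` is the square of the symmetric matrix `√f(B)`, so the quadratic form is a squared norm.
-/
theorem inner_cfc_nonneg {f : ℝ → ℝ} (hf : ∀ t ∈ spectrum ℝ B, 0 ≤ f t)
    (u : Stack M d) : 0 ≤ ⟪u, applyMat (cfc f B) u⟫_ℝ := by
  have h : cfc f B = cfc (fun t => Real.sqrt (f t)) B * cfc (fun t => Real.sqrt (f t)) B := by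
    rw [← cfc_mul_cfc]
    exact cfc_congr fun t ht => (Real.mul_self_sqrt (hf t ht)).symm
  rw [h, applyMat_mul, inner_applyMat_right, transpose_cfc]
  exact real_inner_self_nonneg

theorem inner_cfc_le_inner_cfc {f g : ℝ → ℝ} (hfg : ∀ t ∈ spectrum ℝ B, f t ≤ g t)
    (u : Stack M d) : ⟪u, applyMat (cfc f B) u⟫_ℝ ≤ ⟪u, applyMat (cfc g B) u⟫_ℝ := by
  have h := inner_cfc_nonneg (f := fun t => g t - f t) (fun t ht => sub_nonneg.2 (hfg t ht)) u
  rw [cfc_sub g f B (continuousOn_spectrum B g) (continuousOn_spectrum B f), applyMat_sub_left,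
    inner_sub_right] at h
  linarith

theorem IsGossip.applyMat_eq_zero_iff (hB : IsGossip B) (z : Stack M d) :
    applyMat B z = 0 ↔ z ∈ consensus M d := by
  rw [DecVI.applyMat_eq_zero_iff]
  simp only [hB.ker_eq]
  constructor
  · intro h i j
    ext c
    exact h c i j
  · intro h c i j
    rw [h i j]

theorem IsGossip.transpose_eq (hB : IsGossip B) : B.transpose = B := by
  have h := hB.posSemidef.isHermitian
  rwa [Matrix.IsHermitian, Matrix.conjTranspose_eq_transpose_of_trivial] at h

/-- The range of a symmetric map is orthogonal to its kernel. This is what keeps all dual iterates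
in the complement of consensus. -/
theorem IsGossip.applyMat_mem (hB : IsGossip B) (z : Stack M d) :
    applyMat B z ∈ (consensus M d)ᗮ := by
  rw [Submodule.mem_orthogonal]
  intro u hu
  rw [inner_applyMat_right, hB.transpose_eq, (hB.applyMat_eq_zero_iff u).2 hu, inner_zero_left]

/-- The pseudo-inverse of a gossip matrix defines a metric on the orthogonal complement of the
consensus space. -/
theorem IsGossip.exists_dualMetric (hB : IsGossip B) (d : ℕ) :
    ∃ D : Stack M d →ₗ[ℝ] Stack M d, D.IsSymmetric ∧
      (∀ y ∈ (consensus M d)ᗮ, ‖y‖ ^ 2 ≤ ⟪y, D y⟫_ℝ) ∧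
      (∀ y, ⟪y, D y⟫_ℝ ≤ charNum B * ‖y‖ ^ 2) ∧
      ∀ y ∈ (consensus M d)ᗮ, ∀ v, ⟪y, D (applyMat B v)⟫_ℝ = ⟪y, v⟫_ℝ := by
  -- Since `0⁻¹ = 0`, this is the Moore–Penrose inverse, and `Q` below is the spectral projection
  -- onto the range of `B`.
  set D := cfc (fun t : ℝ => t⁻¹) B with hD
  set Q := cfc (fun t : ℝ => t⁻¹ * t) B with hQ
  have hcase : ∀ t ∈ spectrum ℝ B, t = 0 ∨ 0 < t := fun t ht =>
    (hB.nonneg ht).eq_or_lt.imp Eq.symm id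
  have hDB : D * B = Q := by
    rw [hQ, cfc_mul_cfc (fun t => t⁻¹) (fun t => t), cfc_id' ℝ B hB.isSelfAdjoint]
  have hBQ : B * Q = B := by
    have hid := cfc_id' ℝ B hB.isSelfAdjoint
    refine Eq.trans ?_ hid
    nth_rw 1 [← hid]
    rw [hQ, ← cfc_mul_cfc (fun t => t)]
    refine cfc_congr fun t ht => ?_
    rcases hcase t ht with rfl | h
    · simp
    · have := h.ne'
      field_simp
  -- `BQ = B` puts `v - Qv` in the kernel of `B`, the consensus space, where `y` pairs to zero.
  have hproj : ∀ y ∈ (consensus M d)ᗮ, ∀ v, ⟪y, applyMat Q v⟫_ℝ = ⟪y, v⟫_ℝ := by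
    intro y hy v
    have h0 : v - applyMat Q v ∈ consensus M d := by
      rw [← hB.applyMat_eq_zero_iff, applyMat_sub, ← applyMat_mul, hBQ, sub_self]
    have := (Submodule.mem_orthogonal' _ _).1 hy _ h0
    rw [inner_sub_right] at this
    linarith
  refine ⟨{ toFun := applyMat D, map_add' := applyMat_add D, map_smul' := applyMat_smul D },
    ?_, ?_, ?_, ?_⟩
  · intro u v
    simp only [LinearMap.coe_mk, AddHom.coe_mk]
    rw [inner_applyMat_right, hD, transpose_cfc]
  · intro y hy
    rw [← real_inner_self_eq_norm_sq, ← hproj y hy y]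
    refine inner_cfc_le_inner_cfc (fun t ht => ?_) y
    rcases hcase t ht with rfl | h
    · simp
    · exact mul_le_of_le_one_right (inv_nonneg.2 h.le) (hB.le_one ht)
  · intro y
    have h : ⟪y, applyMat D y⟫_ℝ ≤ ⟪y, applyMat (cfc (fun _ => charNum B) B) y⟫_ℝ := by
      refine inner_cfc_le_inner_cfc (fun t ht => ?_) y
      rcases hcase t ht with rfl | h
      · simpa using zero_le_one.trans hB.one_le_charNum
      · simpa using inv_anti₀ (inv_pos.2 (by linarith [hB.one_le_charNum]))
          (hB.inv_charNum_le ht h)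
    rw [cfc_const _ B hB.isSelfAdjoint, Algebra.algebraMap_eq_smul_one, applyMat_smul_left,
      applyMat_one, real_inner_smul_right, real_inner_self_eq_norm_sq] at h
    exact h
  · intro y hy v
    simp only [LinearMap.coe_mk, AddHom.coe_mk]
    rw [← applyMat_mul, hDB, hproj y hy]

theorem yStar_mem {n : ℕ} (F : Fin M → Fin n → Vec d → Vec d) (zs : Vec d) :
    yStar F zs ∈ (consensus M d)ᗮ := by
  rw [Submodule.mem_orthogonal']
  intro u hu
  rcases Nat.eq_zero_or_pos M with rfl | hM
  · rw [Subsingleton.elim u 0, inner_zero_right]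
  have hu' : ∀ i, u i = u ⟨0, hM⟩ := fun i => hu _ _
  rw [PiLp.inner_apply]
  simp_rw [hu', ← sum_inner]
  have hM' : (M : ℝ) ≠ 0 := by exact_mod_cast hM.ne'
  have : ∑ i, yStar F zs i = 0 := by
    simp [yStar, stack, Finset.sum_sub_distrib, ← Nat.cast_smul_eq_nsmul ℝ, smul_smul, hM']
  rw [this, inner_zero_left]

end DualMetric

/-! ### The proximal operator -/

section Prox

theorem exists_real_eq {x : EReal} (h : x ≠ ⊤) (h' : x ≠ ⊥) : ∃ r : ℝ, x = r :=
  ⟨x.toReal, (EReal.coe_toReal h h').symm⟩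

variable {E : Type*} [NormedAddCommGroup E] [InnerProductSpace ℝ E]

/-- Existence of the minimizer that defines the proximal operator, for a lower semicontinuous
function with an affine minorant that is exact at a point. -/
theorem exists_prox [FiniteDimensional ℝ E] {h : E → EReal} (hbot : ∀ u, h u ≠ ⊥)
    (hlsc : LowerSemicontinuous h) {zs c : E} (hzs : h zs ≠ ⊤)
    (hsub : ∀ u, h u ≠ ⊤ → (h zs).toReal ≤ (h u).toReal + ⟪c, u - zs⟫_ℝ)
    {ρ : ℝ} (hρ : 0 < ρ) (v : E) :
    ∃ x, ∀ u, (ρ : EReal) * h x + ((‖x - v‖ ^ 2 / 2 : ℝ) : EReal) ≤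
      (ρ : EReal) * h u + ((‖u - v‖ ^ 2 / 2 : ℝ) : EReal) := by
  -- Outside the ball of this radius about `zs`, the quadratic growth dominates the affine minorant
  -- and the objective is at least its value at `zs`. The minimum over the compact ball is therefore
  -- global.
  set R := 2 * ‖zs - v‖ + 2 * ρ * ‖c‖
  have hR : 0 ≤ R := by positivity
  have hψ : LowerSemicontinuous fun u => h u + ((‖u - v‖ ^ 2 / (2 * ρ) : ℝ) : EReal) := by
    refine hlsc.add' ?_ fun u => ?_
    · have : Continuous fun u : E => ((‖u - v‖ ^ 2 / (2 * ρ) : ℝ) : EReal) :=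
        continuous_coe_real_ereal.comp (by fun_prop)
      exact this.lowerSemicontinuous
    · exact EReal.continuousAt_add (Or.inr (EReal.coe_ne_bot _)) (Or.inr (EReal.coe_ne_top _))
  obtain ⟨x, -, hx⟩ := LowerSemicontinuousOn.exists_isMinOn
    (s := Metric.closedBall zs R) ⟨zs, Metric.mem_closedBall_self hR⟩
    (have := FiniteDimensional.proper_real E; isCompact_closedBall zs R)
    (hψ.lowerSemicontinuousOn _)
  have hxzs := hx (Metric.mem_closedBall_self hR : zs ∈ Metric.closedBall zs R)
  obtain ⟨a, ha⟩ := exists_real_eq hzs (hbot zs)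
  have hxtop : h x ≠ ⊤ := by
    intro htop
    simp only [Set.mem_ofPred_eq, htop, ha] at hxzs
    rw [EReal.top_add_coe, ← EReal.coe_add] at hxzs
    exact EReal.coe_ne_top _ (top_le_iff.1 hxzs)
  obtain ⟨r, hr⟩ := exists_real_eq hxtop (hbot x)
  have hall : ∀ u (s : ℝ), h u = s → r + ‖x - v‖ ^ 2 / (2 * ρ) ≤ s + ‖u - v‖ ^ 2 / (2 * ρ) := by
    intro u s hs
    by_cases hu : u ∈ Metric.closedBall zs R
    · have := hx hu
      simp only [Set.mem_ofPred_eq, hr, hs] at this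
      exact_mod_cast this
    · simp only [Set.mem_ofPred_eq, hr, ha] at hxzs
      have h1 : r + ‖x - v‖ ^ 2 / (2 * ρ) ≤ a + ‖zs - v‖ ^ 2 / (2 * ρ) := by exact_mod_cast hxzs
      have h2 := hsub u (by simp [hs])
      rw [hs, ha, EReal.toReal_coe, EReal.toReal_coe] at h2
      rw [Metric.mem_closedBall, dist_eq_norm, not_le] at hu
      have h3 : ‖u - v‖ ^ 2 = ‖u - zs‖ ^ 2 + 2 * ⟪u - zs, zs - v⟫_ℝ + ‖zs - v‖ ^ 2 := by
        rw [← norm_add_sq_real]; congr 2; abel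
      have h4 := neg_le_of_abs_le (abs_real_inner_le_norm (u - zs) (zs - v))
      have h5 := le_of_abs_le (abs_real_inner_le_norm c (u - zs))
      have h6 : ‖zs - v‖ ^ 2 / (2 * ρ) + ‖c‖ * ‖u - zs‖ ≤ ‖u - v‖ ^ 2 / (2 * ρ) := by
        rw [div_add' _ _ _ (by positivity), div_le_div_iff_of_pos_right (by positivity), h3]
        nlinarith [mul_le_mul_of_nonneg_left hu.le (norm_nonneg (u - zs))]
      linarith
  refine ⟨x, fun u => ?_⟩
  by_cases hu : h u = ⊤
  · rw [hu, EReal.coe_mul_top_of_pos hρ, EReal.top_add_coe]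
    exact le_top
  · obtain ⟨s, hs⟩ := exists_real_eq hu (hbot u)
    have h1 := mul_le_mul_of_nonneg_left (hall u s hs) hρ.le
    have h2 : ∀ q y : ℝ, ρ * (q + y / (2 * ρ)) = ρ * q + y / 2 := by
      intro q y
      field_simp
    rw [h2, h2] at h1
    rw [hr, hs]
    exact_mod_cast h1

/-- The variational inequality of the proximal operator, tested at a point where `-c` is a
subgradient. -/
theorem inner_prox_sub_le [FiniteDimensional ℝ E] {h : E → EReal} (hbot : ∀ u, h u ≠ ⊥)
    (hlsc : LowerSemicontinuous h)
    (hconv : ∀ u w, h u ≠ ⊤ → h w ≠ ⊤ → ∀ t : ℝ, 0 < t → t ≤ 1 →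
      h (u + t • (w - u)) ≤ (((1 - t) * (h u).toReal + t * (h w).toReal : ℝ) : EReal))
    {zs c : E} (hzs : h zs ≠ ⊤)
    (hsub : ∀ u, h u ≠ ⊤ → (h zs).toReal ≤ (h u).toReal + ⟪c, u - zs⟫_ℝ)
    {ρ : ℝ} (hρ : 0 < ρ) (v : E) :
    ⟪prox ρ h v - v - ρ • c, prox ρ h v - zs⟫_ℝ ≤ 0 := by
  have hx := Classical.epsilon_spec (exists_prox hbot hlsc hzs hsub hρ v)
  change ∀ u, (ρ : EReal) * h (prox ρ h v) + ((‖prox ρ h v - v‖ ^ 2 / 2 : ℝ) : EReal) ≤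
      (ρ : EReal) * h u + ((‖u - v‖ ^ 2 / 2 : ℝ) : EReal) at hx
  generalize prox ρ h v = x at hx
  obtain ⟨a, ha⟩ := exists_real_eq hzs (hbot zs)
  have hxtop : h x ≠ ⊤ := by
    intro htop
    have := hx zs
    rw [htop, ha, EReal.coe_mul_top_of_pos hρ, EReal.top_add_coe, ← EReal.coe_mul,
      ← EReal.coe_add] at this
    exact EReal.coe_ne_top _ (top_le_iff.1 this)
  obtain ⟨r, hr⟩ := exists_real_eq hxtop (hbot x)
  -- Compare `x` with the point `x + t(zs - x)`, use convexity of `h` on the segment, and divide by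
  -- `t`. Letting `t → 0` gives `h0`.
  have hmin : ∀ t : ℝ, 0 < t → t ≤ 1 →
      0 ≤ ρ * (a - r) + ⟪x - v, zs - x⟫_ℝ + t * (‖zs - x‖ ^ 2 / 2) := by
    intro t ht ht1
    have h1 := hconv x zs hxtop hzs t ht ht1
    rw [hr, ha, EReal.toReal_coe, EReal.toReal_coe] at h1
    obtain ⟨s, hs⟩ := exists_real_eq (ne_top_of_le_ne_top (EReal.coe_ne_top _) h1) (hbot _)
    have h2 := hx (x + t • (zs - x))
    rw [hs] at h1
    rw [hs, hr] at h2
    have h3 : s ≤ (1 - t) * r + t * a := by exact_mod_cast h1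
    have h4 : ρ * r + ‖x - v‖ ^ 2 / 2 ≤ ρ * s + ‖x + t • (zs - x) - v‖ ^ 2 / 2 := by
      exact_mod_cast h2
    have h5 : ‖x + t • (zs - x) - v‖ ^ 2 =
        ‖x - v‖ ^ 2 + 2 * (t * ⟪x - v, zs - x⟫_ℝ) + t ^ 2 * ‖zs - x‖ ^ 2 := by
      rw [show x + t • (zs - x) - v = (x - v) + t • (zs - x) by abel, norm_add_sq_real,
        real_inner_smul_right, norm_smul, mul_pow, Real.norm_eq_abs, sq_abs]
    rw [h5] at h4
    have h6 := mul_le_mul_of_nonneg_left h3 hρ.le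
    have h7 : 0 ≤ t * (ρ * (a - r) + ⟪x - v, zs - x⟫_ℝ + t * (‖zs - x‖ ^ 2 / 2)) := by linarith
    exact nonneg_of_mul_nonneg_right h7 ht
  have h0 : 0 ≤ ρ * (a - r) + ⟪x - v, zs - x⟫_ℝ := by
    by_contra hneg
    push Not at hneg
    set q := ρ * (a - r) + ⟪x - v, zs - x⟫_ℝ
    set y := ‖zs - x‖ ^ 2 / 2
    have hy : 0 ≤ y := by positivity
    -- This `t` makes `t * y` at most half of `-q`, contradicting `hmin` if `q < 0`.
    have ht : 0 < min 1 (-q / (2 * (y + 1))) :=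
      lt_min one_pos (div_pos (by linarith) (by linarith))
    have h1 := hmin _ ht (min_le_left _ _)
    have h2 : min 1 (-q / (2 * (y + 1))) * y ≤ -q / 2 := by
      calc min 1 (-q / (2 * (y + 1))) * y ≤ -q / (2 * (y + 1)) * (y + 1) := by
            refine mul_le_mul (min_le_right _ _) (by linarith) hy (ht.le.trans (min_le_right _ _))
        _ = -q / 2 := by field_simp
    linarith
  have h1 := hsub x hxtop
  rw [hr, ha, EReal.toReal_coe, EReal.toReal_coe] at h1
  have h2 := mul_le_mul_of_nonneg_left h1 hρ.le
  rw [inner_sub_left, real_inner_smul_left]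
  have h3 : ⟪x - v, zs - x⟫_ℝ = -⟪x - v, x - zs⟫_ℝ := by rw [← inner_neg_right, neg_sub]
  linarith

end Prox

/-! ### The lifted nonsmooth term `𝐠` and its proximal inequality -/

section LiftFun

variable {M n d : ℕ} {g : Vec d → EReal}

theorem liftFun_eq_coe {z : Stack M d} {r : Fin M → ℝ} (h : ∀ m, g (z m) = r m) :
    liftFun g z = (((M : ℝ)⁻¹ * ∑ m, r m : ℝ) : EReal) := by
  have : ∑ m, g (z m) = ((∑ m, r m : ℝ) : EReal) := by
    simp_rw [h]
    induction (Finset.univ : Finset (Fin M)) using Finset.cons_induction with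
    | empty => simp
    | cons a s ha ih => rw [Finset.sum_cons, Finset.sum_cons, EReal.coe_add, ih]
  rw [liftFun, this, EReal.coe_mul]

theorem sum_ne_bot {ι : Type*} {f : ι → EReal} (hf : ∀ i, f i ≠ ⊥) (s : Finset ι) :
    ∑ i ∈ s, f i ≠ ⊥ := by
  induction s using Finset.cons_induction with
  | empty => simp
  | cons a s ha ih =>
    rw [Finset.sum_cons, EReal.add_ne_bot_iff]
    exact ⟨hf a, ih⟩

theorem sum_eq_top {ι : Type*} {f : ι → EReal} (hf : ∀ i, f i ≠ ⊥) (s : Finset ι) {i : ι}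
    (hi : i ∈ s) (htop : f i = ⊤) : ∑ i ∈ s, f i = ⊤ := by
  classical
  rw [← Finset.add_sum_erase s f hi, htop, EReal.top_add_of_ne_bot (sum_ne_bot hf _)]

theorem liftFun_ne_top (hM : 0 < M) (hbot : ∀ x, g x ≠ ⊥) {z : Stack M d}
    (hz : liftFun g z ≠ ⊤) (m : Fin M) : g (z m) ≠ ⊤ := by
  intro htop
  apply hz
  rw [liftFun, sum_eq_top (fun i => hbot _) Finset.univ (Finset.mem_univ m) htop,
    EReal.coe_mul_top_of_pos (by positivity)]

/-- Addition of extended reals is discontinuous only at `⊤ + ⊥`, which cannot occur because `g`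
avoids `⊥`. -/
theorem lowerSemicontinuous_liftFun (hM : 0 < M) (hbot : ∀ x, g x ≠ ⊥)
    (hg : LowerSemicontinuous g) : LowerSemicontinuous (liftFun g : Stack M d → EReal) := by
  have hsum : ∀ s : Finset (Fin M), LowerSemicontinuous fun z : Stack M d => ∑ m ∈ s, g (z m) := by
    intro s
    induction s using Finset.cons_induction with
    | empty => simpa using lowerSemicontinuous_const
    | cons a s ha ih =>
      simp only [Finset.sum_cons]
      refine LowerSemicontinuous.add' (hg.comp (by fun_prop : Continuous fun z : Stack M d => z a)) ih fun z => ?_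
      exact EReal.continuousAt_add (Or.inr (sum_ne_bot (fun i => hbot _) s)) (Or.inl (hbot _))
  have hpos : (0 : ℝ) < (M : ℝ)⁻¹ := by positivity
  have hne : (((M : ℝ)⁻¹ : ℝ) : EReal) ≠ 0 := by exact_mod_cast hpos.ne'
  have hcont : Continuous fun x : EReal => (((M : ℝ)⁻¹ : ℝ) : EReal) * x := by
    rw [continuous_iff_continuousAt]
    intro x
    exact ContinuousAt.comp (g := fun p : EReal × EReal => p.1 * p.2)
      (f := fun x : EReal => ((((M : ℝ)⁻¹ : ℝ) : EReal), x))
      (EReal.continuousAt_mul (Or.inl hne) (Or.inl hne) (Or.inl (EReal.coe_ne_bot _))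
        (Or.inl (EReal.coe_ne_top _))) (by fun_prop)
  refine hcont.comp_lowerSemicontinuous (hsum Finset.univ) fun x y hxy => ?_
  exact mul_le_mul_of_nonneg_left hxy (by exact_mod_cast hpos.le)

theorem IsProperLscConvex.le_of_segment (hg : IsProperLscConvex g) {u w : Vec d} {a b : ℝ}
    (ha : g u = a) (hb : g w = b) {t : ℝ} (h0 : 0 < t) (h1 : t ≤ 1) :
    g (u + t • (w - u)) ≤ (((1 - t) * a + t * b : ℝ) : EReal) := by
  have := hg.convex (x := (u, a)) (by simp [ha]) (y := (w, b)) (by simp [hb])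
    (sub_nonneg.2 h1) h0.le (by ring)
  simp only [Prod.smul_mk, Prod.mk_add_mk, Set.mem_ofPred_eq, smul_eq_mul] at this
  convert this using 2
  rw [smul_sub, sub_smul, one_smul]
  abel

/-- Every block of `𝐅(z*) - y*` equals `(1/M) ∑ₗ F_l(z*)`. Averaging the variational inequality over
the blocks thus says that minus this vector is a subgradient of `𝐠` at the stacked solution, as
`inner_prox_sub_le` requires; all values of `𝐠` then drop out. -/
theorem inner_prox_liftFun_le (hM : 0 < M) {F : Fin M → Fin n → Vec d → Vec d} {zs : Vec d}
    (hg : IsProperLscConvex g) (hzs : IsSolution F g zs) {η : ℝ} (hη : 0 < η) (v : Stack M d) :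
    ⟪prox η (liftFun g) v - v - η • (liftOp F (stack fun _ => zs) - yStar F zs),
      prox η (liftFun g) v - stack fun _ => zs⟫_ℝ ≤ 0 := by
  obtain ⟨a, ha⟩ := exists_real_eq hzs.1 (hg.ne_bot zs)
  have hM' : (M : ℝ) ≠ 0 := by positivity
  have hlift : liftFun g (stack fun _ : Fin M => zs) = ((M : ℝ)⁻¹ * ∑ _m : Fin M, a : ℝ) :=
    liftFun_eq_coe fun m => ha
  have hreal : ∀ z : Stack M d, liftFun g z ≠ ⊤ → ∃ r : Fin M → ℝ, (∀ m, g (z m) = r m) ∧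
      liftFun g z = ((M : ℝ)⁻¹ * ∑ m, r m : ℝ) := by
    intro z hz
    choose r hr using fun m => exists_real_eq (liftFun_ne_top hM hg.ne_bot hz m) (hg.ne_bot _)
    exact ⟨r, hr, liftFun_eq_coe hr⟩
  refine inner_prox_sub_le ?_ (lowerSemicontinuous_liftFun hM hg.ne_bot hg.lsc) ?_ ?_ ?_ hη v
  · intro u hu
    obtain ⟨r, -, h⟩ := hreal u (by rw [hu]; exact bot_ne_top)
    rw [h] at hu
    exact EReal.coe_ne_bot _ hu
  · intro u w hu hw t ht ht1
    obtain ⟨r, hr, hru⟩ := hreal u hu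
    obtain ⟨s, hs, hsw⟩ := hreal w hw
    have hle : ∀ m, g ((u + t • (w - u)) m) ≤ (((1 - t) * r m + t * s m : ℝ) : EReal) :=
      fun m => hg.le_of_segment (hr m) (hs m) ht ht1
    choose q hq using fun m =>
      exists_real_eq (ne_top_of_le_ne_top (EReal.coe_ne_top _) (hle m)) (hg.ne_bot _)
    rw [liftFun_eq_coe hq, hru, hsw, EReal.toReal_coe, EReal.toReal_coe, EReal.coe_le_coe_iff]
    have hq' : ∀ m, q m ≤ (1 - t) * r m + t * s m := fun m => by
      have := hle m
      rw [hq m] at this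
      exact_mod_cast this
    calc (M : ℝ)⁻¹ * ∑ m, q m ≤ (M : ℝ)⁻¹ * ∑ m, ((1 - t) * r m + t * s m) := by
          gcongr with m
          exact hq' m
      _ = _ := by rw [Finset.sum_add_distrib, ← Finset.mul_sum, ← Finset.mul_sum]; ring
  · rw [hlift]
    exact EReal.coe_ne_top _
  · intro u hu
    obtain ⟨r, hr, hru⟩ := hreal u hu
    rw [hlift, hru, EReal.toReal_coe, EReal.toReal_coe]
    have h1 : ∀ m, a ≤ r m + ⟪∑ m, localOp F m zs, u m - zs⟫_ℝ := fun m => by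
      have := hzs.2 (u m)
      rw [ha, hr m] at this
      exact_mod_cast this
    have h2 : ⟪liftOp F (stack fun _ => zs) - yStar F zs, u - stack fun _ => zs⟫_ℝ =
        (M : ℝ)⁻¹ * ∑ m, ⟪∑ m, localOp F m zs, u m - zs⟫_ℝ := by
      rw [PiLp.inner_apply, Finset.mul_sum]
      refine Finset.sum_congr rfl fun m _ => ?_
      rw [← real_inner_smul_left]
      congr 1
      simp [liftOp, yStar, stack]
    rw [h2, ← mul_add, ← Finset.sum_add_distrib]
    gcongr with m
    exact h1 m

end LiftFun

/-! ### Averages over random batches -/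

section Batch

open scoped BigOperators

theorem sum_pi_apply {ι β γ : Type*} [Fintype ι] [DecidableEq ι] [Fintype β] [AddCommMonoid γ]
    (m : ι) (f : β → γ) :
    ∑ j : ι → β, f (j m) = Fintype.card ({k // k ≠ m} → β) • ∑ i, f i := by
  rw [Fintype.sum_equiv (Equiv.funSplitAt m β) (fun j : ι → β => f (j m)) (fun q => f q.1)
    (fun j => rfl), Fintype.sum_prod_type]
  simp [Finset.smul_sum]

theorem expect_pi_apply {ι β : Type*} [Fintype ι] [DecidableEq ι] [Fintype β] [Nonempty β]
    (m : ι) (f : β → ℝ) : 𝔼 j : ι → β, f (j m) = 𝔼 i, f i := by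
  rw [Fintype.expect_equiv (Equiv.funSplitAt m β) (fun j : ι → β => f (j m)) (fun q => f q.1)
    (fun j => rfl)]
  rw [← Finset.univ_product_univ, Finset.expect_product]
  simp

variable {A E : Type*} [Fintype A] [NormedAddCommGroup E] [InnerProductSpace ℝ E]

theorem expect_inner_eq_zero {X : A → E} (hX : ∑ a, X a = 0) (u : E) :
    𝔼 a, ⟪X a, u⟫_ℝ = 0 := by
  rw [Fintype.expect_eq_sum_div_card, ← sum_inner, hX, inner_zero_left, zero_div]

theorem expect_cons {b : ℕ} (f : (Fin (b + 1) → A) → ℝ) :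
    𝔼 κ, f κ = 𝔼 a : A, 𝔼 κ : Fin b → A, f (Fin.cons a κ) := by
  rw [← Fintype.expect_equiv (Fin.consEquiv fun _ => A)
    (fun q : A × (Fin b → A) => f (Fin.cons q.1 q.2)) f (fun q => rfl),
    ← Finset.univ_product_univ, Finset.expect_product]

theorem expect_inner_sum_eq_zero [Nonempty A] {X : A → E} (hX : ∑ a, X a = 0) (b : ℕ) (u : E) :
    𝔼 κ : Fin b → A, ⟪∑ l, X (κ l), u⟫_ℝ = 0 := by
  classical
  simp_rw [sum_inner]
  rw [Finset.expect_sum_comm]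
  refine Finset.sum_eq_zero fun l _ => ?_
  rw [expect_pi_apply l fun a => ⟪X a, u⟫_ℝ, expect_inner_eq_zero hX]

/-- Variances of independent centered terms add: splitting off one draw, the cross term with the
others averages to zero. -/
theorem expect_norm_sq_sum [Nonempty A] {X : A → E} (hX : ∑ a, X a = 0) (b : ℕ) :
    𝔼 κ : Fin b → A, ‖∑ l, X (κ l)‖ ^ 2 = b * 𝔼 a, ‖X a‖ ^ 2 := by
  induction b with
  | zero => simp
  | succ b ih =>
    rw [expect_cons]
    simp_rw [Fin.sum_univ_succ, Fin.cons_zero, Fin.cons_succ, norm_add_sq_real]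
    simp_rw [Finset.expect_add_distrib, Fintype.expect_const, ih]
    have h : ∀ a : A, 𝔼 κ : Fin b → A, 2 * ⟪X a, ∑ l, X (κ l)⟫_ℝ = 0 := by
      intro a
      simp_rw [real_inner_comm _ (X a)]
      rw [← Finset.mul_expect, expect_inner_sum_eq_zero hX, mul_zero]
    simp_rw [h]
    rw [Finset.expect_const_zero]
    push_cast
    ring

/-- The variance is the second moment minus the squared norm of the mean. -/
theorem sum_norm_sq_sub_mean_le {n : ℕ} (hn : 0 < n) (x : Fin n → E) :
    ∑ i, ‖x i - (n : ℝ)⁻¹ • ∑ k, x k‖ ^ 2 ≤ ∑ i, ‖x i‖ ^ 2 := by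
  have hn' : (n : ℝ) ≠ 0 := by positivity
  simp_rw [norm_sub_sq_real]
  rw [Finset.sum_add_distrib, Finset.sum_sub_distrib, ← Finset.mul_sum, ← sum_inner]
  set S := ∑ k, x k
  rw [real_inner_smul_right, real_inner_self_eq_norm_sq, norm_smul, mul_pow, Real.norm_eq_abs,
    sq_abs]
  simp only [Finset.sum_const, Finset.card_univ, Fintype.card_fin, nsmul_eq_mul]
  have : (n : ℝ) * ((n : ℝ)⁻¹ ^ 2 * ‖S‖ ^ 2) = (n : ℝ)⁻¹ * ‖S‖ ^ 2 := by field_simp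
  rw [this]
  have : 0 ≤ (n : ℝ)⁻¹ * ‖S‖ ^ 2 := by positivity
  linarith

end Batch

/-! ### Batches of lifted samples and the average over one iteration -/

section Sampling

open scoped BigOperators

variable {M n b d : ℕ}

/-- The average of a batch of `b` lifted samples of the family `ζ`. -/
noncomputable def batchMean (ζ : Fin M → Fin n → Vec d) (κ : Fin M → Fin b → Fin n) : Stack M d :=
  (b : ℝ)⁻¹ • ∑ l, stack fun m => ζ m (κ m l)

/-- The mean of the lifted samples of the family `ζ`. -/
noncomputable def fullMean (ζ : Fin M → Fin n → Vec d) : Stack M d :=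
  stack fun m => (n : ℝ)⁻¹ • ∑ i, ζ m i

/-- A lifted sample of `ζ`, minus its mean. -/
noncomputable def centered (ζ : Fin M → Fin n → Vec d) (j : Fin M → Fin n) : Stack M d :=
  (stack fun m => ζ m (j m)) - fullMean ζ

theorem sum_centered (hn : 0 < n) (ζ : Fin M → Fin n → Vec d) : ∑ j, centered ζ j = 0 := by
  have hn' : (n : ℝ) ≠ 0 := by positivity
  ext1 m
  have h := sum_pi_apply (ι := Fin M) m fun i : Fin n => ζ m i - (n : ℝ)⁻¹ • ∑ k, ζ m k
  simp only [WithLp.ofLp_sum, centered, stack, fullMean, Finset.sum_apply]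
  refine h.trans ?_
  rw [Finset.sum_sub_distrib, Finset.sum_const, Finset.card_univ, Fintype.card_fin,
    ← Nat.cast_smul_eq_nsmul ℝ n, smul_smul, mul_inv_cancel₀ hn', one_smul, sub_self, smul_zero]
  rfl

theorem batchMean_sub_fullMean (hb : 0 < b) (ζ : Fin M → Fin n → Vec d)
    (κ : Fin M → Fin b → Fin n) :
    batchMean ζ κ - fullMean ζ = (b : ℝ)⁻¹ • ∑ l, centered ζ fun m => κ m l := by
  have hb' : (b : ℝ) ≠ 0 := by positivity
  simp only [batchMean, centered]
  rw [Finset.sum_sub_distrib, Finset.sum_const, Finset.card_univ, Fintype.card_fin,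
    ← Nat.cast_smul_eq_nsmul ℝ b, smul_sub, smul_smul, inv_mul_cancel₀ hb', one_smul]

theorem expect_swap (f : (Fin b → Fin M → Fin n) → ℝ) :
    𝔼 κ : Fin M → Fin b → Fin n, f (fun l m => κ m l) = 𝔼 κ : Fin b → Fin M → Fin n, f κ :=
  Fintype.expect_equiv (Equiv.piComm fun _ _ => Fin n) _ _ fun _ => rfl

theorem expect_inner_batchMean (hn : 0 < n) (hb : 0 < b) (ζ : Fin M → Fin n → Vec d)
    (u : Stack M d) :
    𝔼 κ : Fin M → Fin b → Fin n, ⟪batchMean ζ κ - fullMean ζ, u⟫_ℝ = 0 := by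
  have : Nonempty (Fin n) := ⟨⟨0, hn⟩⟩
  simp_rw [batchMean_sub_fullMean hb, real_inner_smul_left]
  rw [← Finset.mul_expect, expect_swap (b := b) fun κ => ⟪∑ l, centered ζ (κ l), u⟫_ℝ,
    expect_inner_sum_eq_zero (sum_centered hn ζ), mul_zero]

/-- The `b` batch elements are independent, which gives the factor `1/b`. Within one element the
squared norm is a sum over blocks, so only the uniform marginal of each worker's index enters. -/
theorem expect_norm_sq_batchMean_le (hn : 0 < n) (hb : 0 < b) (ζ : Fin M → Fin n → Vec d) :
    𝔼 κ : Fin M → Fin b → Fin n, ‖batchMean ζ κ - fullMean ζ‖ ^ 2 ≤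
      (b : ℝ)⁻¹ * ∑ m, (n : ℝ)⁻¹ * ∑ i, ‖ζ m i‖ ^ 2 := by
  have : Nonempty (Fin n) := ⟨⟨0, hn⟩⟩
  have hb' : (b : ℝ) ≠ 0 := by positivity
  simp_rw [batchMean_sub_fullMean hb, norm_smul, mul_pow]
  rw [← Finset.mul_expect, expect_swap (b := b) fun κ => ‖∑ l, centered ζ (κ l)‖ ^ 2,
    expect_norm_sq_sum (sum_centered hn ζ), ← mul_assoc]
  have h1 : ‖(b : ℝ)⁻¹‖ ^ 2 * b = (b : ℝ)⁻¹ := by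
    rw [Real.norm_eq_abs, sq_abs]; field_simp
  rw [h1]
  have h2 : ∀ j : Fin M → Fin n, ‖centered ζ j‖ ^ 2 =
      ∑ m, ‖ζ m (j m) - (n : ℝ)⁻¹ • ∑ k, ζ m k‖ ^ 2 := fun j => by
    rw [PiLp.norm_sq_eq_of_L2]; rfl
  simp_rw [h2]
  rw [Finset.expect_sum_comm]
  gcongr with m
  rw [expect_pi_apply m fun i => ‖ζ m i - (n : ℝ)⁻¹ • ∑ k, ζ m k‖ ^ 2,
    Fintype.expect_eq_sum_div_card, Fintype.card_fin, div_eq_inv_mul]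
  exact mul_le_mul_of_nonneg_left (sum_norm_sq_sub_mean_le hn (ζ m)) (by positivity)

/-- The expectation of a function of the random choices of one iteration. -/
noncomputable def sampleMean (p : ℝ) (f : Sample M n b → ℝ) : ℝ := ∑ s, sampleProb p s * f s

theorem sampleMean_eq_expect (p : ℝ) (f : Sample M n b → ℝ) :
    sampleMean p f = 𝔼 i : Fin M → Fin b → Fin n, 𝔼 j : Fin M → Fin b → Fin n,
      (p * f (i, j, true) + (1 - p) * f (i, j, false)) := by
  simp_rw [Fintype.expect_eq_sum_div_card]
  have hcard : (Fintype.card (Fin M → Fin b → Fin n) : ℝ) = (n : ℝ) ^ (M * b) := by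
    simp [pow_mul, mul_comm M b]
  rw [hcard, sampleMean, Fintype.sum_prod_type]
  simp_rw [Fintype.sum_prod_type, Fintype.sum_bool, div_eq_inv_mul, ← inv_pow, Finset.mul_sum]
  refine Finset.sum_congr rfl fun i _ => Finset.sum_congr rfl fun j _ => ?_
  simp only [sampleProb]
  simp
  ring

/-- Iterated averaging: coin first, then the second batch with the first one frozen, then the first
batch. The remainder `R₂` may depend on the first batch because `z^{k+1}` does. -/
theorem sampleMean_le (hn : 0 < n) {p : ℝ} (hp0 : 0 ≤ p) (hp1 : p ≤ 1) {f : Sample M n b → ℝ}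
    {c : ℝ} {R₁ : (Fin M → Fin b → Fin n) → ℝ}
    {R₂ : (Fin M → Fin b → Fin n) → (Fin M → Fin b → Fin n) → ℝ} {R₃ : Bool → ℝ}
    (hf : ∀ i j q, f (i, j, q) ≤ c + R₁ i + R₂ i j + R₃ q)
    (h₁ : 𝔼 i, R₁ i ≤ 0) (h₂ : ∀ i, 𝔼 j, R₂ i j ≤ 0)
    (h₃ : p * R₃ true + (1 - p) * R₃ false ≤ 0) : sampleMean p f ≤ c := by
  have : Nonempty (Fin n) := ⟨⟨0, hn⟩⟩
  rw [sampleMean_eq_expect]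
  calc _ ≤ 𝔼 i : Fin M → Fin b → Fin n, 𝔼 j : Fin M → Fin b → Fin n, (c + R₁ i + R₂ i j) := by
        refine Finset.expect_le_expect fun i _ => Finset.expect_le_expect fun j _ => ?_
        have h4 := mul_le_mul_of_nonneg_left (hf i j true) hp0
        have h5 := mul_le_mul_of_nonneg_left (hf i j false) (sub_nonneg.2 hp1)
        linarith
    _ ≤ 𝔼 i : Fin M → Fin b → Fin n, (c + R₁ i) := by
        refine Finset.expect_le_expect fun i _ => ?_
        rw [Finset.expect_add_distrib, Fintype.expect_const]
        linarith [h₂ i]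
    _ ≤ c := by
        rw [Finset.expect_add_distrib, Fintype.expect_const]
        linarith

end Sampling

/-! ### Lifted operators -/

section LiftOp

variable {M n d : ℕ} {F : Fin M → Fin n → Vec d → Vec d} {μ L Lbar : ℝ}

theorem IsLip.norm_liftOp_sub_le (hF : IsLip F L Lbar) (hL : 0 ≤ L) (u v : Stack M d) :
    ‖liftOp F u - liftOp F v‖ ≤ L * ‖u - v‖ := by
  refine le_of_sq_le_sq ?_ (by positivity)
  rw [mul_pow, PiLp.norm_sq_eq_of_L2, PiLp.norm_sq_eq_of_L2, Finset.mul_sum]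
  gcongr with m
  rw [← mul_pow]
  exact pow_le_pow_left₀ (norm_nonneg _) (hF.lip m (u m) (v m)) 2

theorem IsStronglyMonotone.inner_liftOp_sub (hF : IsStronglyMonotone F μ) (u v : Stack M d) :
    μ * ‖u - v‖ ^ 2 ≤ ⟪liftOp F u - liftOp F v, u - v⟫_ℝ := by
  rw [PiLp.norm_sq_eq_of_L2, PiLp.inner_apply, Finset.mul_sum]
  gcongr with m
  exact hF m (u m) (v m)

theorem IsLip.sum_norm_sq_le (hF : IsLip F L Lbar) (u v : Stack M d) :
    ∑ m, (n : ℝ)⁻¹ * ∑ i, ‖F m i (u m) - F m i (v m)‖ ^ 2 ≤ Lbar ^ 2 * ‖u - v‖ ^ 2 := by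
  rw [PiLp.norm_sq_eq_of_L2, Finset.mul_sum]
  exact Finset.sum_le_sum fun m _ => hF.avg_lip m (u m) (v m)

theorem IsLip.sum_norm_sq_extrapolate_le (hF : IsLip F L Lbar) (u v w : Stack M d) (α : ℝ) :
    ∑ m, (n : ℝ)⁻¹ * ∑ i, ‖(F m i (u m) - F m i (v m)) +
        α • (F m i (u m) - F m i (w m))‖ ^ 2 ≤
      2 * (Lbar ^ 2 * ‖u - v‖ ^ 2) + 2 * α ^ 2 * (Lbar ^ 2 * ‖u - w‖ ^ 2) := by
  have h : ∀ x y : Vec d, ‖x + α • y‖ ^ 2 ≤ 2 * ‖x‖ ^ 2 + 2 * α ^ 2 * ‖y‖ ^ 2 := by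
    intro x y
    have h1 := norm_add_le x (α • y)
    have h2 : ‖α • y‖ ^ 2 = α ^ 2 * ‖y‖ ^ 2 := by
      rw [norm_smul, mul_pow, Real.norm_eq_abs, sq_abs]
    nlinarith [norm_nonneg (x + α • y), sq_nonneg (‖x‖ - ‖α • y‖)]
  calc _ ≤ ∑ m, (n : ℝ)⁻¹ * ∑ i, (2 * ‖F m i (u m) - F m i (v m)‖ ^ 2 +
        2 * α ^ 2 * ‖F m i (u m) - F m i (w m)‖ ^ 2) := by
        gcongr
        exact h _ _
    _ = 2 * (∑ m, (n : ℝ)⁻¹ * ∑ i, ‖F m i (u m) - F m i (v m)‖ ^ 2) +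
        2 * α ^ 2 * (∑ m, (n : ℝ)⁻¹ * ∑ i, ‖F m i (u m) - F m i (w m)‖ ^ 2) := by
        simp only [Finset.sum_add_distrib, Finset.mul_sum, mul_add, mul_left_comm]
    _ ≤ _ := by
        gcongr
        · exact hF.sum_norm_sq_le u v
        · exact hF.sum_norm_sq_le u w

end LiftOp

/-! ### The deterministic inequalities behind one iteration -/

section OneStep

variable {E : Type*} [NormedAddCommGroup E] [InnerProductSpace ℝ E]

/-- Twice the hypothesis, rewritten by polarization. `Fzp` and `yp` are arbitrary and cancel; they
are inserted to exhibit the telescoping products and the dual coupling. The noise is split at `z`,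
since `⟪e, z - zs⟫` has mean zero while `⟪e, zp - z⟫` can be absorbed. -/
theorem primal_step {zs ys Fs z zp w y ym yp Fz Fzm Fzp e : E} {α γ η : ℝ}
    (h : ⟪zp - (z + γ • (w - z) - η • (Fz + α • (Fz - Fzm) + e - (y + α • (y - ym)))) -
      η • (Fs - ys), zp - zs⟫_ℝ ≤ 0) :
    ‖zp - zs‖ ^ 2 + (1 - γ) * ‖zp - z‖ ^ 2 + γ * ‖zp - w‖ ^ 2 ≤
      (1 - γ) * ‖z - zs‖ ^ 2 + γ * ‖w - zs‖ ^ 2 -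
        2 * η * (⟪Fzp - Fs, zp - zs⟫_ℝ - ⟪Fzp - Fz, zp - zs⟫_ℝ +
          α * (⟪Fz - Fzm, z - zs⟫_ℝ + ⟪Fz - Fzm, zp - z⟫_ℝ) + ⟪e, z - zs⟫_ℝ + ⟪e, zp - z⟫_ℝ -
          ⟪yp - ys, zp - zs⟫_ℝ + ⟪yp - y, zp - zs⟫_ℝ -
          α * (⟪y - ym, z - zs⟫_ℝ + ⟪y - ym, zp - z⟫_ℝ)) := by
  simp only [← real_inner_self_eq_norm_sq, inner_sub_left, inner_sub_right, inner_add_left,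
    real_inner_smul_left] at h ⊢
  rw [real_inner_comm z zp, real_inner_comm w zp, real_inner_comm zs zp, real_inner_comm zs z,
    real_inner_comm zs w] at *
  nlinarith [h, real_inner_comm z w, real_inner_comm w z]

/-- Polarization in the metric `D`. The vectors `zs` and `Fs - ys` lie in `K` and pair to zero with
`yp - ys`. The `β`-part is `2⟪a, f - c⟫ ≤ ‖f‖² + ‖a - c‖² - ‖c‖²`, whose last term makes the dual
error contract. -/
theorem dual_step {K : Submodule ℝ E} {D : E →ₗ[ℝ] E} (hD : D.IsSymmetric)
    {zs ys Fs zp y yp Fzp e : E} {θ β : ℝ} (hθβ : 0 ≤ θ * β)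
    (hys : ys ∈ Kᗮ) (hyp : yp ∈ Kᗮ) (hzs : zs ∈ K) (hFs : Fs - ys ∈ K)
    (h : ∀ u ∈ Kᗮ, ⟪u, D (yp - y)⟫_ℝ = -(θ * ⟪u, zp - β • (Fzp + e - y)⟫_ℝ)) :
    ⟪yp - ys, D (yp - ys)⟫_ℝ ≤ ⟪y - ys, D (y - ys)⟫_ℝ - ⟪yp - y, D (yp - y)⟫_ℝ -
      2 * θ * ⟪yp - ys, zp - zs⟫_ℝ +
      θ * β * (‖Fzp - Fs + e‖ ^ 2 + ‖yp - y‖ ^ 2 - ‖y - ys‖ ^ 2) := by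
  have hu : yp - ys ∈ Kᗮ := sub_mem hyp hys
  have h1 : ⟪yp - ys, zs⟫_ℝ = 0 := (Submodule.mem_orthogonal' _ _).1 hu _ hzs
  have h2 : ⟪yp - ys, Fs - ys⟫_ℝ = 0 := (Submodule.mem_orthogonal' _ _).1 hu _ hFs
  have h3 := h _ hu
  have h4 : ⟪yp - ys, zp - β • (Fzp + e - y)⟫_ℝ =
      ⟪yp - ys, zp - zs⟫_ℝ - β * ⟪yp - ys, (Fzp - Fs + e) - (y - ys)⟫_ℝ := by
    have h5 : (Fzp - Fs + e) - (y - ys) = (Fzp + e - y) - (Fs - ys) := by abel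
    rw [h5, inner_sub_right _ (Fzp + e - y), h2, inner_sub_right _ zp zs, h1, inner_sub_right,
      real_inner_smul_right]
    ring
  rw [h4] at h3
  have h5 : 2 * ⟪yp - ys, (Fzp - Fs + e) - (y - ys)⟫_ℝ ≤
      ‖Fzp - Fs + e‖ ^ 2 + ‖yp - y‖ ^ 2 - ‖y - ys‖ ^ 2 := by
    have h6 : ‖yp - y‖ ^ 2 = ‖yp - ys‖ ^ 2 - 2 * ⟪yp - ys, y - ys⟫_ℝ + ‖y - ys‖ ^ 2 := by
      rw [← norm_sub_sq_real]; congr 2; abel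
    have h7 := norm_sub_sq_real (yp - ys) (Fzp - Fs + e)
    have h8 := sq_nonneg ‖yp - ys - (Fzp - Fs + e)‖
    rw [inner_sub_right]
    linarith
  have h6 := mul_le_mul_of_nonneg_left h5 hθβ
  have h7 : ⟪yp - ys, D (yp - ys)⟫_ℝ + ⟪yp - y, D (yp - y)⟫_ℝ - ⟪y - ys, D (y - ys)⟫_ℝ =
      2 * ⟪yp - ys, D (yp - y)⟫_ℝ := by
    have h8 : y - ys = (yp - ys) - (yp - y) := by abel
    have h9 : ⟪yp - y, D (yp - ys)⟫_ℝ = ⟪yp - ys, D (yp - y)⟫_ℝ := by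
      rw [← hD, real_inner_comm]
    rw [h8]
    generalize yp - ys = u at h9
    generalize yp - y = v at h9
    simp only [map_sub, inner_sub_left, inner_sub_right, h9]
    ring
  linarith

/-- The inequalities between the parameters of the method that its analysis uses. -/
structure Admissible (μ L Lbar p : ℝ) (b : ℕ) (χ : ℝ) (c : Params) : Prop where
  η_pos : 0 < c.η
  θ_pos : 0 < c.θ
  β_pos : 0 < c.β
  γ_eq : c.γ = p
  η_L : 16 * c.η * L ≤ 1
  η_Lbar : 16 * c.η ^ 2 * Lbar ^ 2 ≤ p * b
  β_L : 4 * c.β * L ^ 2 ≤ μ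
  β_Lbar : 4 * c.η * c.β * Lbar ^ 2 ≤ p * b
  β_θ : 2 * c.β * c.θ ≤ 1
  η_θ : 16 * c.η * c.θ ≤ 1
  η_μ : c.η * μ ≤ 1
  half_le_α : 1 / 2 ≤ c.α
  α_le_one : c.α ≤ 1
  le_α_μ : 1 - μ * c.η / 4 ≤ c.α
  le_α_χ : 1 - c.β * c.θ * χ⁻¹ ≤ c.α
  le_α_p : 1 - p * c.η * μ / (2 * p + c.η * μ) ≤ c.α

/-- The Lyapunov function of the method, in terms of `z, z⁻, w, w⁻, y, y⁻, F(z), F(z⁻)` and of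
the metric `D`. -/
noncomputable def lyapunov (μ p : ℝ) (c : Params) (D : E →ₗ[ℝ] E)
    (zs ys z zm w wm y ym Fz Fzm : E) : ℝ :=
  (1 + c.η * μ) * ‖z - zs‖ ^ 2 + (1 + c.η * μ / (2 * p)) * ‖w - zs‖ ^ 2 +
    c.η / c.θ * ⟪y - ys, D (y - ys)⟫_ℝ + 3 / 16 * ‖z - zm‖ ^ 2 + 3 / 4 * p * ‖z - wm‖ ^ 2 +
    c.η / c.θ / 2 * ‖y - ym‖ ^ 2 - 2 * c.η * ⟪Fz - Fzm, z - zs⟫_ℝ +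
    2 * c.η * ⟪y - ym, z - zs⟫_ℝ

variable {μ L Lbar p χ : ℝ} {b : ℕ} {c : Params}

theorem Admissible.eight_mul_sq_le (hc : Admissible μ L Lbar p b χ c) :
    8 * c.η ^ 2 ≤ c.η / c.θ / 2 := by
  have h1 := hc.η_pos
  have h2 := hc.θ_pos
  rw [le_div_iff₀ two_pos, le_div_iff₀ h2]
  nlinarith [mul_le_mul_of_nonneg_left hc.η_θ h1.le]

theorem Admissible.two_mul_inner_F_le (hc : Admissible μ L Lbar p b χ c)
    {G u v : E} (hG : ‖G‖ ≤ L * ‖u‖) : 2 * c.η * |⟪G, v⟫_ℝ| ≤ (‖u‖ ^ 2 + ‖v‖ ^ 2) / 16 := by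
  have h1 := abs_real_inner_le_norm G v
  have h2 := mul_le_mul_of_nonneg_right hG (norm_nonneg v)
  have h3 : c.η * |⟪G, v⟫_ℝ| ≤ c.η * L * (‖u‖ * ‖v‖) := by
    rw [mul_assoc]
    exact mul_le_mul_of_nonneg_left (h1.trans (h2.trans_eq (mul_assoc _ _ _))) hc.η_pos.le
  have h4 : c.η * L * (‖u‖ * ‖v‖) ≤ 1 / 16 * (‖u‖ * ‖v‖) := by
    have := hc.η_L
    gcongr
    linarith
  nlinarith [sq_nonneg (‖u‖ - ‖v‖)]

/-- Young's inequality with the weight that `lyapunov` gives to the dual increment; `16ηθ ≤ 1` makes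
this weight at least `8η²`. -/
theorem Admissible.two_mul_inner_y_le (hc : Admissible μ L Lbar p b χ c) (u v : E) :
    2 * c.η * |⟪u, v⟫_ℝ| ≤ c.η / c.θ / 2 * ‖u‖ ^ 2 + ‖v‖ ^ 2 / 8 := by
  have h1 := mul_le_mul_of_nonneg_left (abs_real_inner_le_norm u v) hc.η_pos.le
  have h2 := mul_le_mul_of_nonneg_right hc.eight_mul_sq_le (sq_nonneg ‖u‖)
  nlinarith [sq_nonneg (8 * c.η * ‖u‖ - ‖v‖)]

/-- The two indefinite cross terms cost at most `1/16 + 1/8` of `‖z - zs‖²`, and their increment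
parts are covered by the increment terms of the function. -/
theorem Admissible.half_le_lyapunov (hc : Admissible μ L Lbar p b χ c) (hμ : 0 < μ) (hp : 0 < p)
    {D : E →ₗ[ℝ] E} {zs ys z zm w wm y ym Fz Fzm : E} (hF : ‖Fz - Fzm‖ ≤ L * ‖z - zm‖)
    (hD : 0 ≤ ⟪y - ys, D (y - ys)⟫_ℝ) :
    1 / 2 * ‖z - zs‖ ^ 2 ≤ lyapunov μ p c D zs ys z zm w wm y ym Fz Fzm := by
  have hη := hc.η_pos
  have hθ := hc.θ_pos
  have h1 := hc.two_mul_inner_F_le (v := z - zs) hF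
  have h2 := hc.two_mul_inner_y_le (y - ym) (z - zs)
  have h3 := mul_le_mul_of_nonneg_left (neg_abs_le ⟪y - ym, z - zs⟫_ℝ) hη.le
  have h4 := mul_le_mul_of_nonneg_left (le_abs_self ⟪Fz - Fzm, z - zs⟫_ℝ) hη.le
  have h5 : 0 ≤ c.η * μ * ‖z - zs‖ ^ 2 := by positivity
  have h6 : 0 ≤ (1 + c.η * μ / (2 * p)) * ‖w - zs‖ ^ 2 := by positivity
  have h7 : 0 ≤ c.η / c.θ * ⟪y - ys, D (y - ys)⟫_ℝ := by positivity
  have h8 : 0 ≤ 3 / 4 * p * ‖z - wm‖ ^ 2 := by positivity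
  have h9 := sq_nonneg ‖z - zs‖
  have h10 := sq_nonneg ‖z - zm‖
  rw [lyapunov]
  linarith

/-- The contraction before averaging. The last three summands belong to the first batch `e`, the
second batch `e'` and the coin that chooses `wp`; each is arranged to have nonpositive conditional
mean. -/
theorem Admissible.lyapunov_step (hc : Admissible μ L Lbar p b χ c) (hμ : 0 < μ) (hp : 0 < p)
    (hp8 : p ≤ 1 / 8) (hb : 0 < b) (hχ : 0 < χ) {K : Submodule ℝ E} {D : E →ₗ[ℝ] E}
    (hD : D.IsSymmetric) (hD₁ : ∀ u ∈ Kᗮ, ‖u‖ ^ 2 ≤ ⟪u, D u⟫_ℝ)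
    (hD₂ : ∀ u, ⟪u, D u⟫_ℝ ≤ χ * ‖u‖ ^ 2)
    {zs ys Fs z zm zp w wm wp y ym yp Fz Fzm Fzp e e' : E}
    (hys : ys ∈ Kᗮ) (hy : y ∈ Kᗮ) (hyp : yp ∈ Kᗮ) (hzs : zs ∈ K) (hFs : Fs - ys ∈ K)
    (hF : ‖Fz - Fzm‖ ≤ L * ‖z - zm‖) (hFp : ‖Fzp - Fs‖ ≤ L * ‖zp - zs‖)
    (hmono : μ * ‖zp - zs‖ ^ 2 ≤ ⟪Fzp - Fs, zp - zs⟫_ℝ)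
    (hprox : ⟪zp - (z + c.γ • (w - z) - c.η • (Fz + c.α • (Fz - Fzm) + e -
      (y + c.α • (y - ym)))) - c.η • (Fs - ys), zp - zs⟫_ℝ ≤ 0)
    (hdual : ∀ u ∈ Kᗮ, ⟪u, D (yp - y)⟫_ℝ =
      -(c.θ * ⟪u, zp - c.β • (Fzp + e' - y)⟫_ℝ)) :
    lyapunov μ p c D zs ys zp z wp w yp y Fzp Fz ≤
      c.α * lyapunov μ p c D zs ys z zm w wm y ym Fz Fzm +
      (2 * c.η ^ 2 * (‖e‖ ^ 2 - (b : ℝ)⁻¹ * (2 * (Lbar ^ 2 * ‖z - wm‖ ^ 2) +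
        2 * c.α ^ 2 * (Lbar ^ 2 * ‖z - zm‖ ^ 2))) - 2 * c.η * ⟪e, z - zs⟫_ℝ) +
      c.η * c.β * (‖e'‖ ^ 2 - (b : ℝ)⁻¹ * (Lbar ^ 2 * ‖zp - w‖ ^ 2) + 2 * ⟪e', Fzp - Fs⟫_ℝ) +
      (1 + c.η * μ / (2 * p)) * (‖wp - zs‖ ^ 2 - p * ‖z - zs‖ ^ 2 - (1 - p) * ‖w - zs‖ ^ 2) := by
  have hη := hc.η_pos
  have hθ := hc.θ_pos
  have hβ := hc.β_pos
  have hα0 : 0 < c.α := by linarith [hc.half_le_α]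
  have hb' : (0 : ℝ) < b := by exact_mod_cast hb
  have hpri := primal_step (yp := yp) (Fzp := Fzp) hprox
  have hdu := dual_step hD (mul_pos hθ hβ).le hys hyp hzs hFs hdual
  rw [hc.γ_eq] at hpri
  set ν := c.η / c.θ with hν
  have hν0 : 0 < ν := div_pos hη hθ
  have hνθ : ν * c.θ = c.η := div_mul_cancel₀ _ hθ.ne'
  -- the dual inequality, scaled
  have hdu' : ν * ⟪yp - ys, D (yp - ys)⟫_ℝ + ν / 2 * ‖yp - y‖ ^ 2 ≤
      c.α * (ν * ⟪y - ys, D (y - ys)⟫_ℝ) - 2 * c.η * ⟪yp - ys, zp - zs⟫_ℝ +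
        c.η * c.β * ‖Fzp - Fs + e'‖ ^ 2 := by
    have h1 := mul_le_mul_of_nonneg_left hdu hν0.le
    have h2 := mul_le_mul_of_nonneg_left (hD₁ _ (sub_mem hyp hy)) hν0.le
    have h3 : ν * (c.θ * c.β * ‖yp - y‖ ^ 2) ≤ ν * (1 / 2 * ‖yp - y‖ ^ 2) := by
      have := hc.β_θ
      gcongr
      linarith
    have hDY : 0 ≤ ⟪y - ys, D (y - ys)⟫_ℝ := (sq_nonneg _).trans (hD₁ _ (sub_mem hy hys))
    have h4 : c.β * c.θ * χ⁻¹ * ⟪y - ys, D (y - ys)⟫_ℝ ≤ c.θ * c.β * ‖y - ys‖ ^ 2 := by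
      calc c.β * c.θ * χ⁻¹ * ⟪y - ys, D (y - ys)⟫_ℝ
          ≤ c.β * c.θ * χ⁻¹ * (χ * ‖y - ys‖ ^ 2) := by
            gcongr
            exact hD₂ _
        _ = c.θ * c.β * ‖y - ys‖ ^ 2 := by field_simp
    have h5 := mul_le_mul_of_nonneg_right hc.le_α_χ hDY
    have h6 : ⟪y - ys, D (y - ys)⟫_ℝ - c.θ * c.β * ‖y - ys‖ ^ 2 ≤
        c.α * ⟪y - ys, D (y - ys)⟫_ℝ := by linarith
    have h7 := mul_le_mul_of_nonneg_left h6 hν0.le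
    have h8 : ν * (c.θ * c.β * ‖Fzp - Fs + e'‖ ^ 2) = c.η * c.β * ‖Fzp - Fs + e'‖ ^ 2 := by
      rw [← hνθ]; ring
    have h9 : ν * (2 * c.θ * ⟪yp - ys, zp - zs⟫_ℝ) = 2 * c.η * ⟪yp - ys, zp - zs⟫_ℝ := by
      rw [← hνθ]; ring
    linarith
  -- The two bounds on `β` serve here: `4βL² ≤ μ` charges the deterministic part to strong
  -- monotonicity, and `4ηβLbar² ≤ pb` charges the variance to the `p‖zp - w‖²` of the primal step.
  have hH : c.η * c.β * ‖Fzp - Fs + e'‖ ^ 2 ≤ c.η * μ / 4 * ‖zp - zs‖ ^ 2 +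
      p / 4 * ‖zp - w‖ ^ 2 +
      c.η * c.β * (‖e'‖ ^ 2 - (b : ℝ)⁻¹ * (Lbar ^ 2 * ‖zp - w‖ ^ 2) +
        2 * ⟪e', Fzp - Fs⟫_ℝ) := by
    have h1 : ‖Fzp - Fs‖ ^ 2 ≤ L ^ 2 * ‖zp - zs‖ ^ 2 := by
      rw [← mul_pow]; exact pow_le_pow_left₀ (norm_nonneg _) hFp 2
    have h2 : c.η * c.β * ‖Fzp - Fs‖ ^ 2 ≤ c.η * μ / 4 * ‖zp - zs‖ ^ 2 := by
      calc c.η * c.β * ‖Fzp - Fs‖ ^ 2 ≤ c.η * c.β * (L ^ 2 * ‖zp - zs‖ ^ 2) := by gcongr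
        _ = c.η * (4 * c.β * L ^ 2) / 4 * ‖zp - zs‖ ^ 2 := by ring
        _ ≤ _ := by
          have := hc.β_L
          gcongr
    have h3 : c.η * c.β * ((b : ℝ)⁻¹ * (Lbar ^ 2 * ‖zp - w‖ ^ 2)) ≤ p / 4 * ‖zp - w‖ ^ 2 := by
      calc c.η * c.β * ((b : ℝ)⁻¹ * (Lbar ^ 2 * ‖zp - w‖ ^ 2)) =
          (4 * c.η * c.β * Lbar ^ 2) / (b * 4) * ‖zp - w‖ ^ 2 := by field_simp
        _ ≤ (p * b) / (b * 4) * ‖zp - w‖ ^ 2 := by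
          have := hc.β_Lbar
          gcongr
        _ = _ := by field_simp
    rw [norm_add_sq_real, real_inner_comm]
    linarith
  -- noise of the first batch
  have hE : 2 * c.η ^ 2 * ((b : ℝ)⁻¹ * (2 * (Lbar ^ 2 * ‖z - wm‖ ^ 2) +
        2 * c.α ^ 2 * (Lbar ^ 2 * ‖z - zm‖ ^ 2))) ≤
      p / 4 * (‖z - wm‖ ^ 2 + ‖z - zm‖ ^ 2) := by
    have hα1 : c.α ^ 2 ≤ 1 := pow_le_one₀ hα0.le hc.α_le_one
    calc _ = (16 * c.η ^ 2 * Lbar ^ 2) / (b * 4) * (‖z - wm‖ ^ 2 + c.α ^ 2 * ‖z - zm‖ ^ 2) := by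
          field_simp; ring
      _ ≤ (p * b) / (b * 4) * (‖z - wm‖ ^ 2 + 1 * ‖z - zm‖ ^ 2) := by
          have := hc.η_Lbar
          gcongr
      _ = _ := by field_simp
  have he : -(2 * c.η * ⟪e, zp - z⟫_ℝ) ≤ 2 * c.η ^ 2 * ‖e‖ ^ 2 + ‖zp - z‖ ^ 2 / 2 := by
    have h1 := norm_add_sq_real ((2 * c.η) • e) (zp - z)
    rw [norm_smul, mul_pow, Real.norm_eq_abs, sq_abs, real_inner_smul_left] at h1
    have h2 := sq_nonneg ‖(2 * c.η) • e + (zp - z)‖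
    linarith
  have hGU : -(2 * c.η * (c.α * ⟪Fz - Fzm, zp - z⟫_ℝ)) ≤
      (‖z - zm‖ ^ 2 + ‖zp - z‖ ^ 2) / 16 := by
    have h1 := hc.two_mul_inner_F_le (v := zp - z) hF
    have h2 : c.α * (2 * c.η * |⟪Fz - Fzm, zp - z⟫_ℝ|) ≤
        1 * ((‖z - zm‖ ^ 2 + ‖zp - z‖ ^ 2) / 16) :=
      mul_le_mul hc.α_le_one h1 (by positivity) zero_le_one
    have h3 := mul_le_mul_of_nonneg_left (neg_abs_le ⟪Fz - Fzm, zp - z⟫_ℝ)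
      (mul_pos hα0 hη).le
    linarith
  have hQU : 2 * c.η * (c.α * ⟪y - ym, zp - z⟫_ℝ) ≤
      c.α * (ν / 2 * ‖y - ym‖ ^ 2) + ‖zp - z‖ ^ 2 / 8 := by
    have h1 := mul_le_mul_of_nonneg_left (hc.two_mul_inner_y_le (y - ym) (zp - z)) hα0.le
    have h2 : c.α * (‖zp - z‖ ^ 2 / 8) ≤ 1 * (‖zp - z‖ ^ 2 / 8) :=
      mul_le_mul_of_nonneg_right hc.α_le_one (by positivity)
    have h3 := mul_le_mul_of_nonneg_left (le_abs_self ⟪y - ym, zp - z⟫_ℝ)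
      (mul_pos hα0 hη).le
    linarith
  -- coefficients of the Lyapunov function
  have hx0 : 0 < c.η * μ := mul_pos hη hμ
  have hz : 1 + c.η * μ / 2 ≤ c.α * (1 + c.η * μ) := by
    have h1 := mul_le_mul_of_nonneg_right hc.le_α_μ (show 0 ≤ 1 + c.η * μ by linarith)
    have h2 := mul_le_mul_of_nonneg_left hc.η_μ hx0.le
    linarith
  -- Equality holds at `α = 1 - pημ/(2p + ημ)`: this is the origin of the third gap in the choice of
  -- `α`.
  have hw : p + (1 + c.η * μ / (2 * p)) * (1 - p) ≤ c.α * (1 + c.η * μ / (2 * p)) := by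
    have h1 := mul_le_mul_of_nonneg_right hc.le_α_p
      (show 0 ≤ 1 + c.η * μ / (2 * p) by positivity)
    refine le_of_eq_of_le ?_ h1
    have : 2 * p + c.η * μ ≠ 0 := by positivity
    field_simp
    ring
  have hz' := mul_le_mul_of_nonneg_right hz (sq_nonneg ‖z - zs‖)
  have hw' := mul_le_mul_of_nonneg_right hw (sq_nonneg ‖w - zs‖)
  have hap : (1 + c.η * μ / (2 * p)) * p = p + c.η * μ / 2 := by field_simp
  have hap' : (1 + c.η * μ / (2 * p)) * (p * ‖z - zs‖ ^ 2) =
      (p + c.η * μ / 2) * ‖z - zs‖ ^ 2 := by rw [← hap]; ring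
  have hV : (1 / 16 + p / 4) * ‖z - zm‖ ^ 2 ≤ c.α * (3 / 16 * ‖z - zm‖ ^ 2) := by
    rw [← mul_assoc]
    refine mul_le_mul_of_nonneg_right ?_ (sq_nonneg _)
    linarith [hc.half_le_α]
  have hVw : p / 4 * ‖z - wm‖ ^ 2 ≤ c.α * (3 / 4 * p * ‖z - wm‖ ^ 2) := by
    rw [← mul_assoc]
    refine mul_le_mul_of_nonneg_right ?_ (sq_nonneg _)
    linarith only [mul_le_mul_of_nonneg_right hc.half_le_α hp.le, hp]
  have hU : p * ‖zp - z‖ ^ 2 ≤ 1 / 8 * ‖zp - z‖ ^ 2 :=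
    mul_le_mul_of_nonneg_right hp8 (sq_nonneg _)
  have hmono' := mul_le_mul_of_nonneg_left hmono hη.le
  have hZp : 0 ≤ c.η * μ * ‖zp - zs‖ ^ 2 := by positivity
  simp only [lyapunov, ← hν]
  -- The budget of `‖zp - z‖²` is tight: `1/2 + 1/16 + 1/8` from the Young inequalities plus `3/16`
  -- for the new potential is `7/8`, available because `p ≤ 1/8`. That of `‖zp - w‖²` is `p/4 + 3p/4
  -- = p`. Of the monotonicity gain `2ημ‖zp - zs‖²`, the new potential takes `ημ`, `hH` takes
  -- `ημ/4`, and the rest is dropped.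
  linarith only [hpri, hdu', hH, hE, he, hGU, hQU, hz', hw', hap', hV, hVw, hU, hmono', hZp]

end OneStep

/-! ### One iteration in expectation -/

section Iteration

open scoped BigOperators

variable {M n d b : ℕ} {F : Fin M → Fin n → Vec d → Vec d} {g : Vec d → EReal}
  {W : Matrix (Fin M) (Fin M) ℝ} {μ L Lbar p : ℝ} {c : Params} {zs : Vec d}

/-- The family of vectors that the batch `S^k` samples. -/
noncomputable def gradFamily (F : Fin M → Fin n → Vec d → Vec d) (α : ℝ) (x : State M d)
    (m : Fin M) (i : Fin n) : Vec d :=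
  (F m i (x.z m) - F m i (x.wPrev m)) + α • (F m i (x.z m) - F m i (x.zPrev m))

/-- The family of vectors that the batch `S^{k+1/2}` samples. -/
def halfFamily (F : Fin M → Fin n → Vec d → Vec d) (w zNew : Stack M d) (m : Fin M)
    (i : Fin n) : Vec d :=
  F m i (zNew m) - F m i (w m)

theorem fullMean_halfFamily (w zNew : Stack M d) :
    fullMean (halfFamily F w zNew) = liftOp F zNew - liftOp F w := by
  ext1 m
  simp [fullMean, halfFamily, liftOp, stack, localOp, Finset.sum_sub_distrib, smul_sub]

theorem fullMean_gradFamily (α : ℝ) (x : State M d) :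
    fullMean (gradFamily F α x) = (liftOp F x.z - liftOp F x.wPrev) +
      α • (liftOp F x.z - liftOp F x.zPrev) := by
  ext1 m
  simp only [fullMean, gradFamily, liftOp, stack, localOp, PiLp.add_apply, PiLp.sub_apply,
    PiLp.smul_apply]
  rw [Finset.sum_add_distrib, ← Finset.smul_sum, Finset.sum_sub_distrib, Finset.sum_sub_distrib]
  module

/-- The new iterate `z^{k+1}`, given the batch `S^k`. -/
noncomputable def newZ (F : Fin M → Fin n → Vec d → Vec d) (g : Vec d → EReal) (c : Params)
    (x : State M d) (i : Fin M → Fin b → Fin n) : Stack M d :=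
  prox c.η (liftFun g) (x.z + c.γ • (x.w - x.z) - c.η • (liftOp F x.z +
    c.α • (liftOp F x.z - liftOp F x.zPrev) +
    (batchMean (gradFamily F c.α x) i - fullMean (gradFamily F c.α x)) -
    (x.y + c.α • (x.y - x.yPrev))))

/-- `𝐅(w⁻)` cancels between the control variate and its mean, leaving the exact extrapolated
operator plus a centered error. -/
theorem step_z (x : State M d) (r : Sample M n b) :
    (step F g W c x r).z = newZ F g c x r.1 := by
  simp only [step, newZ]
  have h : batchMean (gradFamily F c.α x) r.1 = (b : ℝ)⁻¹ • (∑ l,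
      ((sampleOp F (fun m => r.1 m l) x.z - sampleOp F (fun m => r.1 m l) x.wPrev) +
        c.α • (sampleOp F (fun m => r.1 m l) x.z - sampleOp F (fun m => r.1 m l) x.zPrev))) :=
    rfl
  rw [← h, fullMean_gradFamily]
  congr 4
  abel

theorem step_y (hW : IsGossip W) (x : State M d) (r : Sample M n b) :
    (step F g W c x r).y = x.y - c.θ • applyMat (chebGossipMat W)
      (newZ F g c x r.1 - c.β • (liftOp F (newZ F g c x r.1) +
        (batchMean (halfFamily F x.w (newZ F g c x r.1)) r.2.1 -
          fullMean (halfFamily F x.w (newZ F g c x r.1))) - x.y)) := by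
  rw [← step_z (W := W)]
  simp only [step, (hW.chebGossip_spec _).1, chebGossipMat, applyMat_smul_left]
  congr 4
  rw [fullMean_halfFamily]
  have h : ∀ z : Stack M d, batchMean (halfFamily F x.w z) r.2.1 = (b : ℝ)⁻¹ • (∑ l,
      (sampleOp F (fun m => r.2.1 m l) z - sampleOp F (fun m => r.2.1 m l) x.w)) := fun _ => rfl
  rw [← h]
  congr 2
  abel

theorem step_y_mem (hW : IsGossip W) {x : State M d} (hx : x.y ∈ (consensus M d)ᗮ)
    (r : Sample M n b) : (step F g W c x r).y ∈ (consensus M d)ᗮ := by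
  rw [step_y hW]
  exact sub_mem hx (Submodule.smul_mem _ _ (hW.isGossip_chebGossipMat.1.applyMat_mem _))

/-- The Lyapunov function at a state of the method. -/
noncomputable def potential (F : Fin M → Fin n → Vec d → Vec d) (μ p : ℝ) (c : Params)
    (D : Stack M d →ₗ[ℝ] Stack M d) (zs : Vec d) (x : State M d) : ℝ :=
  lyapunov μ p c D (stack fun _ => zs) (yStar F zs) x.z x.zPrev x.w x.wPrev x.y x.yPrev
    (liftOp F x.z) (liftOp F x.zPrev)

/-- The noise vectors of `Admissible.lyapunov_step` are the centered batch means. `newZ` depends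
only on the first batch, so the second one is still unbiased given it. The coin remainder averages
to exactly zero. -/
theorem sampleMean_potential_le (hM : 0 < M) (hn : 0 < n) (hb : 0 < b) (hW : IsGossip W)
    (hc : Admissible μ L Lbar p b (charNum (chebGossipMat W)) c) (hμ : 0 < μ) (hL : 0 < L)
    (hp : 0 < p) (hp8 : p ≤ 1 / 8) (hF : IsLip F L Lbar) (hmono : IsStronglyMonotone F μ)
    (hg : IsProperLscConvex g) (hzs : IsSolution F g zs) {D : Stack M d →ₗ[ℝ] Stack M d}
    (hD : D.IsSymmetric) (hD₁ : ∀ u ∈ (consensus M d)ᗮ, ‖u‖ ^ 2 ≤ ⟪u, D u⟫_ℝ)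
    (hD₂ : ∀ u, ⟪u, D u⟫_ℝ ≤ charNum (chebGossipMat W) * ‖u‖ ^ 2)
    (hD₃ : ∀ u ∈ (consensus M d)ᗮ, ∀ v, ⟪u, D (applyMat (chebGossipMat W) v)⟫_ℝ = ⟪u, v⟫_ℝ)
    {x : State M d} (hx : x.y ∈ (consensus M d)ᗮ) :
    sampleMean p (fun r : Sample M n b => potential F μ p c D zs (step F g W c x r)) ≤
      c.α * potential F μ p c D zs x := by
  have hB := hW.isGossip_chebGossipMat.1
  set ζ := gradFamily F c.α x with hζ
  refine sampleMean_le hn hp.le (by linarith)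
    (R₁ := fun i => 2 * c.η ^ 2 * (‖batchMean ζ i - fullMean ζ‖ ^ 2 - (b : ℝ)⁻¹ *
      (2 * (Lbar ^ 2 * ‖x.z - x.wPrev‖ ^ 2) +
        2 * c.α ^ 2 * (Lbar ^ 2 * ‖x.z - x.zPrev‖ ^ 2))) -
      2 * c.η * ⟪batchMean ζ i - fullMean ζ, x.z - stack fun _ => zs⟫_ℝ)
    (R₂ := fun i j => c.η * c.β *
      (‖batchMean (halfFamily F x.w (newZ F g c x i)) j -
          fullMean (halfFamily F x.w (newZ F g c x i))‖ ^ 2 -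
        (b : ℝ)⁻¹ * (Lbar ^ 2 * ‖newZ F g c x i - x.w‖ ^ 2) +
        2 * ⟪batchMean (halfFamily F x.w (newZ F g c x i)) j -
          fullMean (halfFamily F x.w (newZ F g c x i)),
          liftOp F (newZ F g c x i) - liftOp F (stack fun _ => zs)⟫_ℝ))
    (R₃ := fun q => (1 + c.η * μ / (2 * p)) * (‖(if q = true then x.z else x.w) -
      stack fun _ => zs‖ ^ 2 - p * ‖x.z - stack fun _ => zs‖ ^ 2 -
        (1 - p) * ‖x.w - stack fun _ => zs‖ ^ 2)) ?_ ?_ ?_ ?_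
  · intro i j q
    have hy := step_y_mem (F := F) (g := g) (c := c) hW hx (i, j, q)
    rw [potential, step_z, step_y hW]
    rw [step_y hW] at hy
    simp only [step]
    refine hc.lyapunov_step hμ hp hp8 hb (zero_lt_one.trans_le hB.one_le_charNum) hD hD₁ hD₂
      (yStar_mem F zs) hx hy (fun _ _ => rfl) ?_ (hF.norm_liftOp_sub_le hL.le _ _)
      (hF.norm_liftOp_sub_le hL.le _ _) (hmono.inner_liftOp_sub _ _)
      (inner_prox_liftFun_le hM hg hzs hc.η_pos _) ?_
    · intro k l
      simp [liftOp, yStar, stack]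
    · intro u hu
      rw [sub_sub_cancel_left, map_neg, map_smul, inner_neg_right, real_inner_smul_right, hD₃ u hu]
  · simp only [Finset.expect_sub_distrib, ← Finset.mul_expect]
    have : Nonempty (Fin n) := ⟨⟨0, hn⟩⟩
    rw [expect_inner_batchMean hn hb, Fintype.expect_const, mul_zero, sub_zero]
    refine mul_nonpos_of_nonneg_of_nonpos (by positivity) (sub_nonpos.2 ?_)
    refine (expect_norm_sq_batchMean_le hn hb ζ).trans ?_
    gcongr
    exact hF.sum_norm_sq_extrapolate_le x.z x.wPrev x.zPrev c.α
  · intro i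
    simp only [Finset.expect_sub_distrib, ← Finset.mul_expect, Finset.expect_add_distrib]
    have : Nonempty (Fin n) := ⟨⟨0, hn⟩⟩
    rw [expect_inner_batchMean hn hb, Fintype.expect_const, mul_zero, add_zero]
    refine mul_nonpos_of_nonneg_of_nonpos (mul_pos hc.η_pos hc.β_pos).le (sub_nonpos.2 ?_)
    refine (expect_norm_sq_batchMean_le hn hb _).trans ?_
    gcongr
    exact hF.sum_norm_sq_le (newZ F g c x i) x.w
  · apply le_of_eq
    simp only [if_true, Bool.false_eq_true, if_false]
    ring

theorem sampleMean_calls_le (hn : 0 < n) (hp0 : 0 ≤ p) (hp1 : p ≤ 1) (x : State M d) :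
    sampleMean p (fun r : Sample M n b => ((step F g W c x r).calls : ℝ)) ≤
      x.calls + (5 * b + p * n) := by
  have : Nonempty (Fin n) := ⟨⟨0, hn⟩⟩
  refine sampleMean_le hn hp0 hp1 (R₁ := fun _ => 0) (R₂ := fun _ _ => 0)
    (R₃ := fun q => (if q = true then (n : ℝ) else 0) - p * n) ?_ ?_ ?_ ?_
  · intro i j q
    apply le_of_eq
    simp only [step]
    push_cast
    ring
  · simp
  · simp
  · apply le_of_eq
    simp only [if_true, Bool.false_eq_true, if_false]
    ring

end Iteration

/-! ### Expectations along the random sequence -/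

section Markov

variable {Ω S : Type*} [MeasurableSpace Ω] [Fintype S] [MeasurableSpace S]
  [MeasurableSingletonClass S] {P : Measure Ω} [IsProbabilityMeasure P] {ξ : ℕ → Ω → S}

theorem integrable_comp_prefix (hξ : ∀ k, Measurable (ξ k)) (k : ℕ)
    (ψ : (Finset.range k → S) → ℝ) : Integrable (fun ω => ψ fun i => ξ i ω) P := by
  have hm : Measurable fun ω (i : Finset.range k) => ξ i ω := measurable_pi_lambda _ fun i => hξ i
  have : IsFiniteMeasure (P.map fun ω (i : Finset.range k) => ξ i ω) := inferInstance
  exact (Integrable.of_finite (f := ψ)).comp_measurable hm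

/-- Conditioning on the past in finite form: split over the value of `ξ k`, whose indicator is
independent of the earlier draws. -/
theorem integral_comp_prefix (hξ : ∀ k, Measurable (ξ k)) (hind : iIndepFun ξ P) (k : ℕ)
    (φ : (Finset.range k → S) → S → ℝ) :
    ∫ ω, φ (fun i => ξ i ω) (ξ k ω) ∂P =
      ∫ ω, ∑ s, P.real (ξ k ⁻¹' {s}) * φ (fun i => ξ i ω) s ∂P := by
  classical
  have hm : Measurable fun ω (i : Finset.range k) => ξ i ω := measurable_pi_lambda _ fun i => hξ i
  have hind' : IndepFun (ξ k) (fun ω (i : Finset.range k) => ξ i ω) P := by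
    have h := hind.indepFun_finset {k} (Finset.range k) (by simp) hξ
    have happ : Measurable fun f : ({k} : Finset ℕ) → S => f ⟨k, Finset.mem_singleton_self k⟩ :=
      measurable_pi_apply _
    exact h.comp happ measurable_id
  have hsplit : ∀ ω, φ (fun i => ξ i ω) (ξ k ω) =
      ∑ s, (if ξ k ω = s then 1 else 0) * φ (fun i => ξ i ω) s := by
    intro ω
    simp
  simp_rw [hsplit]
  have hmeas : ∀ s, MeasurableSet (ξ k ⁻¹' {s}) := fun s => hξ k (measurableSet_singleton s)
  have hint : ∀ s, ∫ ω, (if ξ k ω = s then (1 : ℝ) else 0) * φ (fun i => ξ i ω) s ∂P =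
      P.real (ξ k ⁻¹' {s}) * ∫ ω, φ (fun i => ξ i ω) s ∂P := by
    intro s
    have h := (hind'.comp (φ := fun t => if t = s then (1 : ℝ) else 0) (ψ := fun t => φ t s)
      (measurable_of_finite _) (measurable_of_finite _)).integral_fun_mul_eq_mul_integral
      ((measurable_of_finite _).comp (hξ k)).aestronglyMeasurable
      ((measurable_of_finite _).comp hm).aestronglyMeasurable
    refine h.trans ?_
    congr 1
    rw [← integral_indicator_one (hmeas s)]
    rfl
  rw [integral_finsetSum, integral_finsetSum]
  · simp_rw [hint, integral_const_mul]
  · intro s _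
    exact (integrable_comp_prefix hξ k fun t => φ t s).const_mul _
  · intro s _
    have h : ∀ ω, (if ξ k ω = s then (1 : ℝ) else 0) * φ (fun i => ξ i ω) s =
        (ξ k ⁻¹' {s}).indicator (fun ω => φ (fun i => ξ i ω) s) ω := by
      intro ω
      simp [Set.indicator_apply]
    simp_rw [h]
    exact (integrable_comp_prefix hξ k fun t => φ t s).indicator (hmeas s)

end Markov

/-! ### Expectations of functions of the state along a run -/

section Run

variable {M n d b : ℕ} {F : Fin M → Fin n → Vec d → Vec d} {g : Vec d → EReal}
  {W : Matrix (Fin M) (Fin M) ℝ} {p : ℝ} {c : Params} {z0 y0 : Stack M d}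
  {Ω : Type*} [MeasurableSpace Ω] {P : Measure Ω} [IsProbabilityMeasure P]
  {ξ : ℕ → Ω → Sample M n b}

theorem run_congr {r r' : ℕ → Sample M n b} {k : ℕ} (h : ∀ i < k, r i = r' i) :
    run F g W c z0 y0 r k = run F g W c z0 y0 r' k := by
  induction k with
  | zero => rfl
  | succ k ih =>
    simp only [run]
    rw [ih fun i hi => h i (hi.trans k.lt_succ_self), h k k.lt_succ_self]

theorem exists_run_eq [Nonempty (Sample M n b)] (F : Fin M → Fin n → Vec d → Vec d)
    (g : Vec d → EReal) (W : Matrix (Fin M) (Fin M) ℝ) (c : Params) (z0 y0 : Stack M d) (k : ℕ) :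
    ∃ R : (Finset.range k → Sample M n b) → State M d,
      ∀ r : ℕ → Sample M n b, run F g W c z0 y0 r k = R fun i => r i := by
  classical
  refine ⟨fun t => run F g W c z0 y0 (fun i => if h : i ∈ Finset.range k then t ⟨i, h⟩ else
    Classical.arbitrary _) k, fun r => run_congr fun i hi => ?_⟩
  rw [dif_pos (Finset.mem_range.2 hi)]

/-- The state factors through the first `k` draws, which take finitely many values. No measurable
structure on states, and no measurability of `prox`, is involved. -/
theorem IsSampling.integrable_run (hξ : IsSampling P p ξ) (k : ℕ) (φ : State M d → ℝ) :
    Integrable (fun ω => φ (run F g W c z0 y0 (fun i => ξ i ω) k)) P := by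
  have : Nonempty Ω := P.nonempty_of_neZero
  have : Nonempty (Sample M n b) := ⟨ξ 0 (Classical.arbitrary Ω)⟩
  obtain ⟨R, hR⟩ := exists_run_eq (n := n) (b := b) F g W c z0 y0 k
  simp_rw [hR]
  exact integrable_comp_prefix hξ.measurable k fun t => φ (R t)

theorem IsSampling.integral_run_succ (hξ : IsSampling P p ξ) (hp0 : 0 ≤ p) (hp1 : p ≤ 1) (k : ℕ)
    (φ : State M d → ℝ) :
    ∫ ω, φ (run F g W c z0 y0 (fun i => ξ i ω) (k + 1)) ∂P =
      ∫ ω, sampleMean p (fun s : Sample M n b =>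
        φ (step F g W c (run F g W c z0 y0 (fun i => ξ i ω) k) s)) ∂P := by
  have : Nonempty Ω := P.nonempty_of_neZero
  have : Nonempty (Sample M n b) := ⟨ξ 0 (Classical.arbitrary Ω)⟩
  obtain ⟨R, hR⟩ := exists_run_eq (n := n) (b := b) F g W c z0 y0 k
  have hP : ∀ s, P.real (ξ k ⁻¹' {s}) = sampleProb p s := by
    intro s
    rw [Measure.real, hξ.law, ENNReal.toReal_ofReal]
    rw [sampleProb]
    have : 0 ≤ if s.2.2 = true then p else 1 - p := by
      split_ifs
      · exact hp0
      · linarith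
    positivity
  simp only [run, hR]
  rw [integral_comp_prefix hξ.measurable hξ.indep k fun t s => φ (step F g W c (R t) s)]
  simp only [hP]
  rfl

theorem IsSampling.integrable_sampleMean_run (hξ : IsSampling P p ξ) (k : ℕ)
    (φ : State M d → ℝ) :
    Integrable (fun ω => sampleMean p (fun s : Sample M n b =>
        φ (step F g W c (run F g W c z0 y0 (fun i => ξ i ω) k) s))) P :=
  hξ.integrable_run k fun x => sampleMean p fun s : Sample M n b => φ (step F g W c x s)

theorem run_y_mem (hW : IsGossip W) (hy0 : y0 ∈ (consensus M d)ᗮ) (r : ℕ → Sample M n b) (k : ℕ) :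
    (run F g W c z0 y0 r k).y ∈ (consensus M d)ᗮ := by
  induction k with
  | zero => exact hy0
  | succ k ih => exact step_y_mem hW ih _

theorem run_rounds_le (hW : IsGossip W) (r : ℕ → Sample M n b) (k : ℕ) :
    ((run F g W c z0 y0 r k).rounds : ℝ) ≤ Real.sqrt (charNum W) * k := by
  induction k with
  | zero => simp [run, initState]
  | succ k ih =>
    simp only [run, step]
    push_cast
    rw [mul_add, mul_one]
    exact add_le_add ih (hW.chebGossip_spec _).2

theorem IsSampling.integral_calls_le (hξ : IsSampling P p ξ) (hn : 0 < n) (hp0 : 0 ≤ p)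
    (hp1 : p ≤ 1) (k : ℕ) :
    ∫ ω, ((run F g W c z0 y0 (fun i => ξ i ω) k).calls : ℝ) ∂P ≤ n + (5 * b + p * n) * k := by
  induction k with
  | zero => simp [run, initState]
  | succ k ih =>
    rw [hξ.integral_run_succ hp0 hp1 k fun x => (x.calls : ℝ)]
    have hint := hξ.integrable_run (F := F) (g := g) (W := W) (c := c) (z0 := z0) (y0 := y0) k
      fun x => (x.calls : ℝ)
    calc _ ≤ ∫ ω, (((run F g W c z0 y0 (fun i => ξ i ω) k).calls : ℝ) + (5 * b + p * n)) ∂P :=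
          integral_mono (hξ.integrable_sampleMean_run k fun x => (x.calls : ℝ))
            (hint.add (integrable_const _)) fun ω => sampleMean_calls_le hn hp0 hp1 _
      _ = ∫ ω, ((run F g W c z0 y0 (fun i => ξ i ω) k).calls : ℝ) ∂P + (5 * b + p * n) := by
          rw [integral_add hint (integrable_const _)]
          simp
      _ ≤ _ := by
          push_cast
          linarith

theorem IsSampling.integral_le_pow_mul (hξ : IsSampling P p ξ) (hp0 : 0 ≤ p) (hp1 : p ≤ 1)
    {φ : State M d → ℝ} {α : ℝ} (hα : 0 ≤ α)
    (h : ∀ k ω, sampleMean p (fun s : Sample M n b =>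
      φ (step F g W c (run F g W c z0 y0 (fun i => ξ i ω) k) s)) ≤
      α * φ (run F g W c z0 y0 (fun i => ξ i ω) k)) (k : ℕ) :
    ∫ ω, φ (run F g W c z0 y0 (fun i => ξ i ω) k) ∂P ≤ α ^ k * φ (initState n z0 y0) := by
  induction k with
  | zero => simp [run]
  | succ k ih =>
    rw [hξ.integral_run_succ hp0 hp1]
    calc _ ≤ ∫ ω, α * φ (run F g W c z0 y0 (fun i => ξ i ω) k) ∂P :=
          integral_mono (hξ.integrable_sampleMean_run k φ) ((hξ.integrable_run k φ).const_mul α)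
            fun ω => h k ω
      _ = α * ∫ ω, φ (run F g W c z0 y0 (fun i => ξ i ω) k) ∂P := integral_const_mul _ _
      _ ≤ α * (α ^ k * φ (initState n z0 y0)) := by gcongr
      _ = _ := by ring

end Run

/-! ### The parameters -/

section Tuning

variable {μ L Lbar p χ : ℝ} {b : ℕ}

theorem tuning_η_mul_L (hL : 0 < L) (hχ : 1 ≤ χ) : 16 * (tuning μ L Lbar p b χ).η * L ≤ 1 := by
  have hs : 1 ≤ Real.sqrt χ := by rw [← Real.sqrt_one]; exact Real.sqrt_le_sqrt hχ
  have h : (tuning μ L Lbar p b χ).η ≤ 1 / (16 * L) :=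
    (min_le_right _ _).trans (one_div_le_one_div_of_le (by positivity)
      (le_mul_of_one_le_right (by positivity) hs))
  rw [le_div_iff₀ (by positivity)] at h
  linarith

theorem tuning_η_pos (hL : 0 < L) (hLb : 0 < Lbar) (hp : 0 < p) (hb : 0 < b) (hχ : 1 ≤ χ) :
    0 < (tuning μ L Lbar p b χ).η := by
  have hb' : (0 : ℝ) < b := by exact_mod_cast hb
  have hs : 0 < Real.sqrt χ := Real.sqrt_pos.2 (by linarith)
  exact lt_min (by positivity) (by positivity)

/-- Each field is one branch of a minimum or maximum. The assumption `μ ≤ L` turns `16ηL ≤ 1` into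
`16ημ ≤ 1`, which also gives `α ≥ 1/2`. -/
theorem admissible_tuning (hμ : 0 < μ) (hL : 0 < L) (hLb : 0 < Lbar) (hμL : μ ≤ L) (hp : 0 < p)
    (hb : 0 < b) (hχ : 1 ≤ χ) : Admissible μ L Lbar p b χ (tuning μ L Lbar p b χ) := by
  have hb' : (0 : ℝ) < b := by exact_mod_cast hb
  have hη := tuning_η_pos (μ := μ) hL hLb hp hb hχ
  have hηL := tuning_η_mul_L (μ := μ) (Lbar := Lbar) (p := p) (b := b) hL hχ
  set c := tuning μ L Lbar p b χ with hc
  have hβdef : c.β = min (μ / (4 * L ^ 2)) (b * p / (4 * c.η * Lbar ^ 2)) := rfl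
  have hθdef : c.θ = min (1 / (2 * c.β)) (1 / (16 * c.η)) := rfl
  have hαdef : c.α = max (max (1 - μ * c.η / 4) (1 - c.β * c.θ * χ⁻¹))
    (1 - p * c.η * μ / (2 * p + c.η * μ)) := rfl
  have hβ : 0 < c.β := by rw [hβdef]; exact lt_min (by positivity) (by positivity)
  have hθ : 0 < c.θ := by rw [hθdef]; exact lt_min (by positivity) (by positivity)
  have hημ : 16 * (c.η * μ) ≤ 1 := by
    have := mul_le_mul_of_nonneg_left hμL hη.le
    linarith
  have h0 : 0 < χ := by linarith
  refine ⟨hη, hθ, hβ, rfl, hηL, ?_, ?_, ?_, ?_, ?_, by linarith, ?_, ?_, ?_, ?_, ?_⟩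
  · have h1 : c.η ≤ Real.sqrt (p * b) / (4 * Lbar) := min_le_left _ _
    rw [le_div_iff₀ (by positivity)] at h1
    calc 16 * c.η ^ 2 * Lbar ^ 2 = (c.η * (4 * Lbar)) ^ 2 := by ring
      _ ≤ Real.sqrt (p * b) ^ 2 := pow_le_pow_left₀ (by positivity) h1 2
      _ = p * b := Real.sq_sqrt (by positivity)
  · have h1 : c.β ≤ μ / (4 * L ^ 2) := min_le_left _ _
    rw [le_div_iff₀ (by positivity)] at h1
    linarith
  · have h1 : c.β ≤ b * p / (4 * c.η * Lbar ^ 2) := min_le_right _ _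
    rw [le_div_iff₀ (by positivity)] at h1
    linarith
  · have h1 : c.θ ≤ 1 / (2 * c.β) := min_le_left _ _
    rw [le_div_iff₀ (by positivity)] at h1
    linarith
  · have h1 : c.θ ≤ 1 / (16 * c.η) := min_le_right _ _
    rw [le_div_iff₀ (by positivity)] at h1
    linarith
  · rw [hαdef]
    exact le_max_of_le_left (le_max_of_le_left (by linarith))
  · rw [hαdef]
    refine max_le (max_le ?_ ?_) ?_
    · have : 0 < μ * c.η / 4 := by positivity
      linarith
    · have : 0 < c.β * c.θ * χ⁻¹ := by positivity
      linarith
    · have : 0 < p * c.η * μ / (2 * p + c.η * μ) := by positivity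
      linarith
  · exact le_max_of_le_left (le_max_left _ _)
  · exact le_max_of_le_left (le_max_right _ _)
  · exact le_max_right _ _

theorem eight_le_rate (hμ : 0 < μ) (hL : 0 < L) (hLb : 0 < Lbar) (hp : 0 < p) (hp8 : p ≤ 1 / 8) :
    8 ≤ rate μ L Lbar p b := by
  have h1 : 8 ≤ 1 / p := by rw [le_div_iff₀ hp]; linarith
  have h2 : 0 ≤ 1 / Real.sqrt (p * b) * (Lbar / μ) := by positivity
  have h3 : 0 ≤ L / μ := by positivity
  rw [rate]
  linarith

/-- The contraction factor of the method. -/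
theorem one_le_rate_mul_one_sub_α (hμ : 0 < μ) (hL : 0 < L) (hLb : 0 < Lbar) (hμL : μ ≤ L)
    (hp : 0 < p) (hp8 : p ≤ 1 / 8) (hb : 0 < b) (hχ : 1 ≤ χ) (hχ4 : χ ≤ 4) :
    1 ≤ 128 * rate μ L Lbar p b * (1 - (tuning μ L Lbar p b χ).α) := by
  have hb' : (0 : ℝ) < b := by exact_mod_cast hb
  have hR8 := eight_le_rate (b := b) hμ hL hLb hp hp8
  have hc := admissible_tuning hμ hL hLb hμL hp hb hχ
  have hRdef : rate μ L Lbar p b =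
    1 / p + (1 / Real.sqrt (p * b) * (Lbar / μ) + L / μ) := by rw [rate]; ring
  set c := tuning μ L Lbar p b χ with hcdef
  have hη := hc.η_pos
  have hβ := hc.β_pos
  have hηdef : c.η = min (Real.sqrt (p * b) / (4 * Lbar)) (1 / (16 * L * Real.sqrt χ)) := rfl
  have hβdef : c.β = min (μ / (4 * L ^ 2)) (b * p / (4 * c.η * Lbar ^ 2)) := rfl
  have hθdef : c.θ = min (1 / (2 * c.β)) (1 / (16 * c.η)) := rfl
  have hαdef : c.α = max (max (1 - μ * c.η / 4) (1 - c.β * c.θ * χ⁻¹))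
    (1 - p * c.η * μ / (2 * p + c.η * μ)) := rfl
  set Q := 1 / Real.sqrt (p * b) * (Lbar / μ) + L / μ with hQ
  set R := rate μ L Lbar p b
  have hp1 : 0 < 1 / p := by positivity
  have hL1 : 0 < L / μ := by positivity
  have hLb1 : 0 < 1 / Real.sqrt (p * b) * (Lbar / μ) := by positivity
  have hQR : Q ≤ R := by linarith
  have hR : 0 < R := by linarith
  have hQ0 : 0 < Q := by positivity
  have hsχ : Real.sqrt χ ≤ 2 := by
    rw [Real.sqrt_le_left (by norm_num)]
    linarith
  have hsχ0 : 0 < Real.sqrt χ := Real.sqrt_pos.2 (by linarith)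
  -- Each branch of `η` is matched with one term of `Q`: the variance branch gives `1/4`, the
  -- Lipschitz branch `1/(16√χ) ≥ 1/32` since `χ ≤ 4`.
  have hηQ : 1 / 32 ≤ c.η * μ * Q := by
    rw [hηdef]
    rcases min_choice (Real.sqrt (p * b) / (4 * Lbar)) (1 / (16 * L * Real.sqrt χ)) with h | h <;>
      rw [h]
    · have hs : 0 < Real.sqrt (p * b) := by positivity
      calc (1 : ℝ) / 32 ≤ Real.sqrt (p * b) / (4 * Lbar) * μ *
            (1 / Real.sqrt (p * b) * (Lbar / μ)) := by
            have : Real.sqrt (p * b) / (4 * Lbar) * μ *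
              (1 / Real.sqrt (p * b) * (Lbar / μ)) = 1 / 4 := by field_simp
            rw [this]; norm_num
        _ ≤ _ := by gcongr; linarith
    · calc (1 : ℝ) / 32 ≤ 1 / (16 * L * 2) * μ * (L / μ) := by
            apply le_of_eq; field_simp; norm_num
        _ ≤ 1 / (16 * L * Real.sqrt χ) * μ * Q := by gcongr; linarith
  have hx : 0 < c.η * μ := mul_pos hη hμ
  have h1 : 1 / (128 * R) ≤ μ * c.η / 4 := by
    rw [div_le_iff₀ (by positivity)]
    have := mul_le_mul_of_nonneg_left hQR hx.le
    linarith
  have h3 : 1 / (128 * R) ≤ p * c.η * μ / (2 * p + c.η * μ) := by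
    rw [div_le_div_iff₀ (by positivity) (by positivity), hRdef]
    have e1 : p * (c.η * μ) * (1 / p) = c.η * μ := by field_simp
    have e2 := mul_le_mul_of_nonneg_left hηQ hp.le
    nlinarith
  have h2 : 1 / (128 * R) ≤ c.β * c.θ * χ⁻¹ := by
    -- `βθ` is the minimum of `1/2` and `β/(16η)`, and `β ≥ 4η/R` in both branches of `β`, by `16ηL
    -- ≤ 1` and `16η²Lbar² ≤ pb`.
    have hβθ : 1 / (4 * R) ≤ c.β * c.θ := by
      rw [hθdef, mul_min_of_nonneg _ _ hβ.le]
      refine le_min ?_ ?_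
      · have : c.β * (1 / (2 * c.β)) = 1 / 2 := by field_simp
        rw [this]
        exact one_div_le_one_div_of_le two_pos (by linarith)
      · have hle : 4 * c.η / R ≤ c.β := by
          rw [hβdef]
          refine le_min ?_ ?_
          · rw [div_le_div_iff₀ hR (by positivity)]
            have e1 : L ≤ μ * R := by
              have : L / μ ≤ R := by linarith
              rwa [div_le_iff₀ hμ, mul_comm] at this
            have e2 : 16 * c.η * L * L ≤ 1 * L :=
              mul_le_mul_of_nonneg_right hc.η_L hL.le
            linarith
          · rw [div_le_div_iff₀ hR (by positivity)]
            have e1 := hc.η_Lbar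
            have e2 : p * b * 1 ≤ p * b * R :=
              mul_le_mul_of_nonneg_left (by linarith) (by positivity)
            linarith
        rw [mul_one_div, div_le_div_iff₀ (by positivity) (by positivity)]
        rw [div_le_iff₀ hR] at hle
        linarith
    have hβθ0 : 0 ≤ c.β * c.θ := (mul_pos hβ hc.θ_pos).le
    calc 1 / (128 * R) ≤ 1 / (4 * R) * 4⁻¹ := by
          rw [div_mul_eq_mul_div, div_le_div_iff₀ (by positivity) (by positivity)]
          linarith
      _ ≤ c.β * c.θ * χ⁻¹ := by gcongr
  have h4 : c.α ≤ 1 - 1 / (128 * R) := by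
    rw [hαdef]
    exact max_le (max_le (by linarith) (by linarith)) (by linarith)
  calc (1 : ℝ) = 128 * R * (1 / (128 * R)) := by field_simp
    _ ≤ 128 * R * (1 - c.α) := by gcongr; linarith

theorem eight_mul_η_mul_sq_le (hμ : 0 < μ) (hL : 0 < L) (hLb : 0 < Lbar) (hμL : μ ≤ L)
    (hp : 0 < p) (hb : 0 < b) (hχ : 1 ≤ χ) :
    8 * (tuning μ L Lbar p b χ).η * L ^ 2 ≤ (tuning μ L Lbar p b χ).θ := by
  have hc := admissible_tuning hμ hL hLb hμL hp hb hχ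
  set c := tuning μ L Lbar p b χ with hcdef
  have hη := hc.η_pos
  have hβ := hc.β_pos
  have hημ : 16 * (c.η * μ) ≤ 1 := by
    have := mul_le_mul_of_nonneg_left hμL hη.le
    linarith [hc.η_L]
  have hθdef : c.θ = min (1 / (2 * c.β)) (1 / (16 * c.η)) := rfl
  rw [hθdef]
  refine le_min ?_ ?_
  · rw [le_div_iff₀ (by positivity)]
    have := mul_le_mul_of_nonneg_left hc.β_L hη.le
    linarith
  · rw [le_div_iff₀ (by positivity)]
    have h1 : (16 * c.η * L) ^ 2 ≤ 1 := pow_le_one₀ (by positivity) hc.η_L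
    nlinarith

end Tuning

/-! ### Convergence -/

section Convergence

variable {M n d b : ℕ} {F : Fin M → Fin n → Vec d → Vec d} {g : Vec d → EReal}
  {W : Matrix (Fin M) (Fin M) ℝ} {μ L Lbar p : ℝ} {z0 y0 : Stack M d} {zs : Vec d}
  {Ω : Type*} [MeasurableSpace Ω] {P : Measure Ω} [IsProbabilityMeasure P]
  {ξ : ℕ → Ω → Sample M n b}

/-- All increments vanish at the start. The primal weight fits in `1/p` because `p ≤ 1/8` and `ημ ≤
1/16`; the dual weight `2(η/θ)χ ≤ 8η/θ` is at most `1/L²` by `eight_mul_η_mul_sq_le`. -/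
theorem potential_initState_le (hμ : 0 < μ) (hL : 0 < L) (hLb : 0 < Lbar) (hμL : μ ≤ L)
    (hp : 0 < p) (hp8 : p ≤ 1 / 8) (hb : 0 < b) {χ : ℝ} (hχ : 1 ≤ χ) (hχ4 : χ ≤ 4)
    {D : Stack M d →ₗ[ℝ] Stack M d} (hD₂ : ∀ u, ⟪u, D u⟫_ℝ ≤ χ * ‖u‖ ^ 2) :
    2 * potential F μ p (tuning μ L Lbar p b χ) D zs (initState n z0 y0) ≤
      ‖z0 - stack (fun _ => zs)‖ ^ 2 / p + ‖y0 - yStar F zs‖ ^ 2 / L ^ 2 := by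
  have hc := admissible_tuning hμ hL hLb hμL hp hb hχ
  have hθ8 := eight_mul_η_mul_sq_le hμ hL hLb hμL hp hb hχ
  set c := tuning μ L Lbar p b χ with hcdef
  have hη := hc.η_pos
  have hθ := hc.θ_pos
  have hημ : 16 * (c.η * μ) ≤ 1 := by
    have := mul_le_mul_of_nonneg_left hμL hη.le
    linarith [hc.η_L]
  simp only [potential, initState, lyapunov, sub_self, norm_zero, inner_zero_left]
  have h1 : 2 * ((1 + c.η * μ) + (1 + c.η * μ / (2 * p))) ≤ 1 / p := by
    rw [le_div_iff₀ hp]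
    have : 2 * ((1 + c.η * μ) + (1 + c.η * μ / (2 * p))) * p =
        4 * p + 2 * (c.η * μ) * p + c.η * μ := by field_simp; ring
    rw [this]
    have := mul_pos hη hμ
    nlinarith
  have h2 : 2 * (c.η / c.θ * ⟪y0 - yStar F zs, D (y0 - yStar F zs)⟫_ℝ) ≤
      ‖y0 - yStar F zs‖ ^ 2 / L ^ 2 := by
    calc _ ≤ 2 * (c.η / c.θ * (4 * ‖y0 - yStar F zs‖ ^ 2)) := by
          gcongr
          exact (hD₂ _).trans (by gcongr)
      _ = (8 * c.η * L ^ 2) / c.θ * (‖y0 - yStar F zs‖ ^ 2 / L ^ 2) := by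
          field_simp
          ring
      _ ≤ 1 * (‖y0 - yStar F zs‖ ^ 2 / L ^ 2) := by
          gcongr
          rwa [div_le_one hθ]
      _ = _ := one_mul _
  have h3 := mul_le_mul_of_nonneg_right h1 (sq_nonneg ‖z0 - stack fun _ => zs‖)
  rw [div_mul_eq_mul_div, one_mul] at h3
  linarith

theorem IsSampling.integral_norm_sq_le (hξ : IsSampling P p ξ) (hM : 0 < M) (hn : 0 < n)
    (hb : 0 < b) (hW : IsGossip W) (hμ : 0 < μ) (hL : 0 < L) (hLb : 0 < Lbar) (hμL : μ ≤ L)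
    (hp : 0 < p) (hp8 : p ≤ 1 / 8) (hF : IsLip F L Lbar) (hmono : IsStronglyMonotone F μ)
    (hg : IsProperLscConvex g) (hzs : IsSolution F g zs) (hy0 : y0 ∈ (consensus M d)ᗮ) (k : ℕ) :
    ∫ ω, ‖(run F g W (tuning μ L Lbar p b (charNum (chebGossipMat W))) z0 y0
        (fun i => ξ i ω) k).z - stack (fun _ => zs)‖ ^ 2 ∂P ≤
      (tuning μ L Lbar p b (charNum (chebGossipMat W))).α ^ k *
        (‖z0 - stack (fun _ => zs)‖ ^ 2 / p + ‖y0 - yStar F zs‖ ^ 2 / L ^ 2) := by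
  obtain ⟨hB, hχ4⟩ := hW.isGossip_chebGossipMat
  have hχ := hB.one_le_charNum
  have hc := admissible_tuning hμ hL hLb hμL hp hb hχ
  obtain ⟨D, hD, hD₁, hD₂, hD₃⟩ := hB.exists_dualMetric d
  have hinit := potential_initState_le (F := F) (z0 := z0) (y0 := y0) (zs := zs) hμ hL hLb hμL
    hp hp8 hb hχ hχ4 hD₂
  set c := tuning μ L Lbar p b (charNum (chebGossipMat W)) with hcdef
  have hα : 0 ≤ c.α := by linarith [hc.half_le_α]
  have hmem : ∀ ω k, (run F g W c z0 y0 (fun i => ξ i ω) k).y ∈ (consensus M d)ᗮ :=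
    fun ω k => run_y_mem hW hy0 _ k
  have hpow := hξ.integral_le_pow_mul (F := F) (g := g) (W := W) (c := c) (z0 := z0) (y0 := y0)
    hp.le (by linarith) hα (φ := potential F μ p c D zs)
    (fun k ω => sampleMean_potential_le hM hn hb hW hc hμ hL hp hp8 hF hmono hg hzs hD hD₁ hD₂
      hD₃ (hmem ω k)) k
  calc _ ≤ ∫ ω, 2 * potential F μ p c D zs (run F g W c z0 y0 (fun i => ξ i ω) k) ∂P := by
        refine integral_mono
          (hξ.integrable_run k fun x : State M d => ‖x.z - stack (fun _ => zs)‖ ^ 2)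
          ((hξ.integrable_run k _).const_mul 2) fun ω => ?_
        have h := hc.half_le_lyapunov (D := D) hμ hp (zs := stack fun _ => zs) (ys := yStar F zs)
          (w := (run F g W c z0 y0 (fun i => ξ i ω) k).w)
          (wm := (run F g W c z0 y0 (fun i => ξ i ω) k).wPrev)
          (ym := (run F g W c z0 y0 (fun i => ξ i ω) k).yPrev)
          (hF.norm_liftOp_sub_le hL.le (run F g W c z0 y0 (fun i => ξ i ω) k).z
            (run F g W c z0 y0 (fun i => ξ i ω) k).zPrev)
          ((sq_nonneg _).trans (hD₁ _ (sub_mem (hmem ω k) (yStar_mem F zs))))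
        simp only [potential]
        linarith
    _ = 2 * ∫ ω, potential F μ p c D zs (run F g W c z0 y0 (fun i => ξ i ω) k) ∂P :=
        integral_const_mul _ _
    _ ≤ 2 * (c.α ^ k * potential F μ p c D zs (initState n z0 y0)) := by gcongr
    _ = c.α ^ k * (2 * potential F μ p c D zs (initState n z0 y0)) := by ring
    _ ≤ _ := by gcongr

theorem half_le_logTerm (hp : 0 < p) {ε : ℝ} (hε : 0 < ε) :
    1 / 2 ≤ logTerm F L p z0 y0 zs ε := by
  have h : Real.log 2 ≤ logTerm F L p z0 y0 zs ε := by
    refine Real.log_le_log two_pos (le_add_of_nonneg_right ?_)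
    positivity
  linarith [Real.log_two_gt_d9]

theorem IsSampling.exists_iterations (hξ : IsSampling P p ξ) (hM : 0 < M) (hn : 0 < n)
    (hb : 0 < b) (hW : IsGossip W) (hμ : 0 < μ) (hL : 0 < L) (hLb : 0 < Lbar)
    (hp : 0 < p) (hp8 : p ≤ 1 / 8) (hF : IsLip F L Lbar) (hmono : IsStronglyMonotone F μ)
    (hg : IsProperLscConvex g) (hzs : IsSolution F g zs) (hy0 : y0 ∈ (consensus M d)ᗮ)
    {ε : ℝ} (hε : 0 < ε) :
    ∃ N : ℕ, (N : ℝ) ≤ 129 * (rate μ L Lbar p b * logTerm F L p z0 y0 zs ε) ∧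
      ∀ k, N ≤ k → ∫ ω, ‖(run F g W (tuning μ L Lbar p b (charNum (chebGossipMat W))) z0 y0
        (fun i => ξ i ω) k).z - stack (fun _ => zs)‖ ^ 2 ∂P ≤ ε := by
  have hR8 := eight_le_rate (b := b) hμ hL hLb hp hp8
  have hℓ : 1 / 2 ≤ logTerm F L p z0 y0 zs ε := half_le_logTerm hp hε
  have hRℓ : 1 ≤ rate μ L Lbar p b * logTerm F L p z0 y0 zs ε := by nlinarith
  rcases le_or_gt μ L with hμL | hLμ
  · obtain ⟨hB, hχ4⟩ := hW.isGossip_chebGossipMat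
    have hχ := hB.one_le_charNum
    have hc := admissible_tuning hμ hL hLb hμL hp hb hχ
    have hrate := one_le_rate_mul_one_sub_α hμ hL hLb hμL hp hp8 hb hχ hχ4
    have hconv := hξ.integral_norm_sq_le hM hn hb hW hμ hL hLb hμL hp hp8 hF hmono hg hzs hy0
      (z0 := z0)
    have hα : 0 ≤ (tuning μ L Lbar p b (charNum (chebGossipMat W))).α := by
      linarith [hc.half_le_α]
    generalize (tuning μ L Lbar p b (charNum (chebGossipMat W))).α = α at hrate hα hconv
    have hα1 : 0 < 1 - α := by
      by_contra h
      push Not at h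
      have : 128 * rate μ L Lbar p b * (1 - α) ≤ 0 :=
        mul_nonpos_of_nonneg_of_nonpos (by linarith) h
      linarith
    -- From here on `α ^ k ≤ exp(-k(1 - α)) ≤ (2 + D/ε)⁻¹`. Rounding up costs at most one, absorbed
    -- because `rate * logTerm ≥ 1`; this turns `128` into `129`.
    refine ⟨⌈logTerm F L p z0 y0 zs ε / (1 - α)⌉₊, ?_, fun k hk => (hconv k).trans ?_⟩
    · have h1 := Nat.ceil_lt_add_one (a := logTerm F L p z0 y0 zs ε / (1 - α)) (by positivity)
      have h2 : logTerm F L p z0 y0 zs ε / (1 - α) ≤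
          128 * (rate μ L Lbar p b * logTerm F L p z0 y0 zs ε) := by
        rw [div_le_iff₀ hα1]
        have := mul_le_mul_of_nonneg_right hrate (show 0 ≤ logTerm F L p z0 y0 zs ε by linarith)
        linarith
      linarith
    · have h1 : logTerm F L p z0 y0 zs ε ≤ k * (1 - α) := by
        rw [← div_le_iff₀ hα1]
        exact (Nat.le_ceil _).trans (by exact_mod_cast hk)
      rw [logTerm] at h1
      set D₀ := ‖z0 - stack (fun _ => zs)‖ ^ 2 / p + ‖y0 - yStar F zs‖ ^ 2 / L ^ 2
      have hD₀ : 0 ≤ D₀ := by positivity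
      have h2 : α ^ k ≤ Real.exp (-(k * (1 - α))) := by
        calc α ^ k ≤ Real.exp (α - 1) ^ k :=
              pow_le_pow_left₀ hα (by linarith [Real.add_one_le_exp (α - 1)]) k
          _ = Real.exp (-(k * (1 - α))) := by rw [← Real.exp_nat_mul]; congr 1; ring
      have h3 : α ^ k ≤ (2 + D₀ / ε)⁻¹ := by
        refine h2.trans ((Real.exp_le_exp.2 (neg_le_neg h1)).trans_eq ?_)
        rw [Real.exp_neg, Real.exp_log (by positivity)]
      calc α ^ k * D₀ ≤ (2 + D₀ / ε)⁻¹ * D₀ := by gcongr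
        _ ≤ ε := by
          rw [inv_mul_le_iff₀ (by positivity), add_mul, div_mul_cancel₀ _ hε.ne']
          linarith
  -- Monotonicity and Cauchy–Schwarz give `μ‖u - v‖² ≤ L‖u - v‖²`, so `μ > L` forces the space to be
  -- a point, and zero iterations suffice.
  · have hsub : ∀ u v : Vec d, u = v := by
      intro u v
      have h1 := hmono ⟨0, hM⟩ u v
      have h2 := real_inner_le_norm (localOp F ⟨0, hM⟩ u - localOp F ⟨0, hM⟩ v) (u - v)
      have h3 := mul_le_mul_of_nonneg_right (hF.lip ⟨0, hM⟩ u v) (norm_nonneg (u - v))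
      have h4 : (μ - L) * ‖u - v‖ ^ 2 ≤ 0 := by linarith
      have h5 : ‖u - v‖ ^ 2 ≤ 0 := by
        by_contra h
        push Not at h
        linarith [mul_pos (sub_pos.2 hLμ) h]
      exact sub_eq_zero.1 (norm_eq_zero.1 (pow_eq_zero_iff two_ne_zero |>.1
        (le_antisymm h5 (sq_nonneg _))))
    refine ⟨0, by simpa using by linarith, fun k _ => ?_⟩
    have h0 : ∀ z : Stack M d, z - stack (fun _ => zs) = 0 := fun z => by
      ext1 m
      exact hsub _ _
    simp only [h0, norm_zero]
    simpa using hε.le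

/-- The iteration complexity for `p = b / n`. -/
theorem rate_of_eq_div (hb : 0 < b) (hn : 0 < n) (hpb : p = b / n) :
    rate μ L Lbar p b = n / b + Real.sqrt n / b * (Lbar / μ) + L / μ := by
  have hb' : (0 : ℝ) < b := by exact_mod_cast hb
  have hn' : (0 : ℝ) < n := by exact_mod_cast hn
  have h1 : Real.sqrt (p * b) = b / Real.sqrt n := by
    rw [hpb, show (b : ℝ) / n * b = b ^ 2 / n by ring, Real.sqrt_div (by positivity),
      Real.sqrt_sq hb'.le]
  rw [rate, h1, hpb, one_div_div, one_div_div]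

end Convergence

end DecVI

/-! ### The complexity theorem -/

open DecVI in
theorem theorem4 :
    ∃ C : ℝ, 0 < C ∧
      ∀ (M n d b : ℕ) (G : SimpleGraph (Fin M)) (W : Matrix (Fin M) (Fin M) ℝ)
        (F : Fin M → Fin n → Vec d → Vec d) (g : Vec d → EReal)
        (μ L Lbar p : ℝ) (z0 y0 : Stack M d) (zs : Vec d)
        (Ω : Type*) [MeasurableSpace Ω] (P : Measure Ω) [IsProbabilityMeasure P]
        (ξ : ℕ → Ω → Sample M n b),
        G.Connected → IsGossipOn G W →
        0 < μ → 0 < L → 0 < Lbar →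
        IsLip F L Lbar → IsStronglyMonotone F μ → IsProperLscConvex g →
        IsSolution F g zs →
        1 ≤ b → b ≤ n → 0 < p → p ≤ 1 / 8 →
        (∀ m, g (z0 m) ≠ ⊤) → y0 ∈ (consensus M d)ᗮ →
        IsSampling P p ξ →
        -- the Chebyshev polynomial gives a gossip matrix with characteristic number at most 4,
        -- and the subroutine multiplies by it in at most `√χ` communication rounds
        (IsGossip (chebGossipMat W) ∧ charNum (chebGossipMat W) ≤ 4 ∧
          ∀ v : Stack M d, (chebGossip W v).1 = applyMat (chebMat W) v ∧
            ((chebGossip W v).2 : ℝ) ≤ Real.sqrt (charNum W)) ∧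
        -- complexity
        ∀ X : ℕ → Ω → State M d,
          (∀ k ω, X k ω = run F g W (tuning μ L Lbar p b (charNum (chebGossipMat W))) z0 y0
            (fun i => ξ i ω) k) →
          ∀ ε : ℝ, 0 < ε → ∃ N : ℕ,
            -- iterations
            (N : ℝ) ≤ C * (rate μ L Lbar p b * logTerm F L p z0 y0 zs ε) ∧
            (∀ k, N ≤ k → Integrable (fun ω => ‖(X k ω).z - stack (fun _ => zs)‖ ^ 2) P ∧
              ∫ ω, ‖(X k ω).z - stack (fun _ => zs)‖ ^ 2 ∂P ≤ ε) ∧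
            -- communication rounds and expected local computations of these iterations
            (∀ ω, ((X N ω).rounds : ℝ) ≤ Real.sqrt (charNum W) * N) ∧
            Integrable (fun ω => ((X N ω).calls : ℝ)) P ∧
            ∫ ω, ((X N ω).calls : ℝ) ∂P ≤ n + 5 * (b + p * n) * N ∧
            -- the choice `p = b / n`
            (p = b / n →
              (∀ ω, ((X N ω).rounds : ℝ) ≤ C * (Real.sqrt (charNum W) *
                (n / b + Real.sqrt n / b * (Lbar / μ) + L / μ) *
                  logTerm F L p z0 y0 zs ε)) ∧
              ∫ ω, ((X N ω).calls : ℝ) ∂P ≤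
                C * ((n + Real.sqrt n * (Lbar / μ) + b * (L / μ)) *
                  logTerm F L p z0 y0 zs ε)) ∧
            -- moreover `b = Lbar √n / L`, up to rounding
            (p = b / n → Lbar * Real.sqrt n / L ≤ b → b ≤ 2 * (Lbar * Real.sqrt n / L) →
              (∀ ω, ((X N ω).rounds : ℝ) ≤ C * (Real.sqrt (charNum W) *
                (Real.sqrt n * (L / Lbar) + L / μ) * logTerm F L p z0 y0 zs ε)) ∧
              ∫ ω, ((X N ω).calls : ℝ) ∂P ≤
                C * ((n + Real.sqrt n * (Lbar / μ)) * logTerm F L p z0 y0 zs ε)) := by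
  -- Any constant above `129`, `258`, `776` and `2328 = 3 · 776`, the factors met below, would do.
  refine ⟨4000, by norm_num, ?_⟩
  intro M n d b G W F g μ L Lbar p z0 y0 zs Ω _ P _ ξ hG hWG hμ hL hLb hF hmono hg hzs hb hbn hp hp8
    _ hy0 hξ
  have hW : IsGossip W := hWG.toIsGossip
  have hM : 0 < M := by
    obtain ⟨i⟩ := hG.nonempty
    exact i.pos
  have hn : 0 < n := hb.trans hbn
  have hb' : (0 : ℝ) < b := by exact_mod_cast hb
  have hn' : (0 : ℝ) < n := by exact_mod_cast hn
  refine ⟨⟨hW.isGossip_chebGossipMat.1, hW.isGossip_chebGossipMat.2,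
    fun v => hW.chebGossip_spec v⟩, ?_⟩
  intro X hX ε hε
  obtain ⟨N, hN, hconv⟩ := hξ.exists_iterations hM hn hb hW hμ hL hLb hp hp8 hF hmono hg hzs hy0
    (z0 := z0) hε
  have hℓ : 1 / 2 ≤ logTerm F L p z0 y0 zs ε := half_le_logTerm hp hε
  have hR8 := eight_le_rate (b := b) hμ hL hLb hp hp8
  have hcalls := hξ.integral_calls_le (F := F) (g := g) (W := W)
    (c := tuning μ L Lbar p b (charNum (chebGossipMat W))) (z0 := z0) (y0 := y0) hn hp.le
    (by linarith) N
  have hrounds : ∀ ω, ((X N ω).rounds : ℝ) ≤ Real.sqrt (charNum W) * N := fun ω => by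
    rw [hX]; exact run_rounds_le hW _ N
  simp_rw [← hX] at hcalls hconv
  set ℓ := logTerm F L p z0 y0 zs ε
  set R := rate μ L Lbar p b with hR
  have hℓ0 : 0 < ℓ := by linarith
  have hRℓ : 0 < R * ℓ := mul_pos (by linarith) hℓ0
  have hs := Real.sqrt_nonneg (charNum W)
  have hrounds' : ∀ ω, ((X N ω).rounds : ℝ) ≤ 129 * (Real.sqrt (charNum W) * R * ℓ) := fun ω =>
    (hrounds ω).trans ((mul_le_mul_of_nonneg_left hN hs).trans_eq (by ring))
  -- With `pn = b` the expected number of calls is at most `n + 6bN`. Here `n ≤ bR ≤ 2bRℓ` and `N ≤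
  -- 129Rℓ`, so the constant is `2 + 6 · 129`.
  have hcalls' : p = b / n → ∫ ω, ((X N ω).calls : ℝ) ∂P ≤ 776 *
      ((n + Real.sqrt n * (Lbar / μ) + b * (L / μ)) * ℓ) := by
    intro hpb
    have h1 : p * n = b := by rw [hpb]; field_simp
    have h2 : b * R = n + Real.sqrt n * (Lbar / μ) + b * (L / μ) := by
      rw [hR, rate_of_eq_div hb hn hpb]; field_simp
    rw [h1] at hcalls
    have h3 := mul_le_mul_of_nonneg_left hN hb'.le
    rw [← h2]
    have h4 : (n : ℝ) ≤ 2 * (b * R * ℓ) := by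
      have h5 : (n : ℝ) ≤ b * R := by
        rw [h2, add_assoc]
        exact le_add_of_nonneg_right (by positivity)
      have h6 := mul_le_mul h5 hℓ (by norm_num) (hn'.le.trans h5)
      linarith
    linarith
  refine ⟨N, hN.trans (by linarith), fun k hk => ⟨?_, hconv k hk⟩, hrounds, ?_, ?_, ?_, ?_⟩
  · simp_rw [hX]
    exact hξ.integrable_run k fun x : State M d => ‖x.z - stack (fun _ => zs)‖ ^ 2
  · simp_rw [hX]
    exact hξ.integrable_run N fun x : State M d => (x.calls : ℝ)
  · have : 0 ≤ p * n * N := by positivity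
    linarith
  · intro hpb
    rw [← rate_of_eq_div hb hn hpb]
    have h1 : 0 ≤ Real.sqrt (charNum W) * R * ℓ := by
      rw [mul_assoc]; exact mul_nonneg hs hRℓ.le
    refine ⟨fun ω => (hrounds' ω).trans (by linarith), (hcalls' hpb).trans ?_⟩
    gcongr
    norm_num
  · intro hpb hb1 hb2
    have hsn : 0 < Real.sqrt n := Real.sqrt_pos.2 hn'
    have hsq : Real.sqrt n * Real.sqrt n = n := Real.mul_self_sqrt hn'.le
    rw [div_le_iff₀ hL] at hb1
    -- The lower bound on `b` controls the two terms of the rate that decrease in `b` (`h1`, `h2`);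
    -- the upper bound controls the increasing cost `b L/μ` (`h3`).
    have h1 : (n : ℝ) / b ≤ Real.sqrt n * (L / Lbar) := by
      rw [div_le_iff₀ hb', ← mul_div_assoc, div_mul_eq_mul_div, le_div_iff₀ hLb]
      calc (n : ℝ) * Lbar = Real.sqrt n * (Lbar * Real.sqrt n) := by linear_combination (-Lbar) * hsq
        _ ≤ Real.sqrt n * (b * L) := by gcongr
        _ = _ := by ring
    have h2 : Real.sqrt n / b * (Lbar / μ) ≤ L / μ := by
      rw [← mul_div_assoc, div_mul_eq_mul_div]
      gcongr
      rw [div_le_iff₀ hb']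
      linarith
    have h3 : b * (L / μ) ≤ 2 * (Real.sqrt n * (Lbar / μ)) := by
      calc b * (L / μ) ≤ 2 * (Lbar * Real.sqrt n / L) * (L / μ) := by gcongr
        _ = _ := by field_simp
    constructor
    · intro ω
      have h4 : R ≤ 2 * (Real.sqrt n * (L / Lbar) + L / μ) := by
        have : 0 ≤ Real.sqrt n * (L / Lbar) := by positivity
        rw [hR, rate_of_eq_div hb hn hpb]
        linarith
      calc ((X N ω).rounds : ℝ) ≤ 129 * (Real.sqrt (charNum W) * R * ℓ) := hrounds' ω
        _ ≤ 129 * (Real.sqrt (charNum W) * (2 * (Real.sqrt n * (L / Lbar) + L / μ)) * ℓ) := by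
          gcongr
        _ = 258 * (Real.sqrt (charNum W) * (Real.sqrt n * (L / Lbar) + L / μ) * ℓ) := by ring
        _ ≤ _ := by gcongr; norm_num
    · calc _ ≤ 776 * ((n + Real.sqrt n * (Lbar / μ) + b * (L / μ)) * ℓ) := hcalls' hpb
        _ ≤ 776 * (3 * (n + Real.sqrt n * (Lbar / μ)) * ℓ) := by
          gcongr
          linarith
        _ = 2328 * ((n + Real.sqrt n * (Lbar / μ)) * ℓ) := by ring
        _ ≤ _ := by gcongr; norm_num
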